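/- Let $S_{\mathbb Z}$ be the group of permutations of $\mathbb Z$ fixing all but finitely many integers, let $\ell(w)$ be the number of pairs $i<j$ with $w(i)>w(j)$, and let $(i,j)$ denote the transposition of $i$ and $j$ (with $(i,i)=1$). Let $<$ be the Bruhat order on $S_{\mathbb Z}$, the weakest strict partial order with $w<wt$ whenever $t$ is a transposition and $\ell(w)<\ell(wt)$, and write $u\lessdot v$ if $\{u\}=\{x\in S_{\mathbb Z}: u\le x<v\}$. Let $\circ$ be the Demazure product, the unique associative operation on $S_{\mathbb Z}$ with $u\circ v=uv$ whenever $\ell(uv)=\ell(u)+\ell(v)$ and with $s\circ s=s$ for $s=(i,i+1)$, $i\in\mathbb Z$. Let $\mathcal I_{\mathbb Z}=\{y\in S_{\mathbb Z}: y=y^{-1}\}$, and for $y\in\mathcal I_{\mathbb Z}$ let $\mathcal A(y)$ be the set of elements $w\in S_{\mathbb Z}$ of minimal length with $y=w^{-1}\circ w$. For a finite set $E\subset\mathbb Z$ of size $n$ let $[w]_E\in S_n$ be the permutation $\psi\circ w|_E\circ\phi$, where $\phi:\{1,\dots,n\}\to E$ and $\psi:w(E)\to\{1,\dots,n\}$ are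 the increasing bijections; permutations in $S_n$ are written in one-line notation. **Theorem.** Let $y\in\mathcal I_{\mathbb Z}$, $w\in\mathcal A(y)$, and let $i<j$ be integers such that $w\lessdot w(i,j)$ and $w(i,j)\notin\mathcal A(z)$ for all $z\in\mathcal I_{\mathbb Z}$. Then: (a) There is a unique pair of integers $i'<j'$ such that $w\neq w(i,j)(i',j')\in\mathcal A(y)$. (b) Let $A=\{i,j,y(i),y(j)\}$. Then $[w]_A\in\{231,312,2431,3412,4213\}$. Moreover $[y]_A$, $[w]_A$, $(i,j)$ and the pair $(i',j')$ of part (a) are as in one of the rows of the following table, in which the elements of $A$ are labeled $a<b<c$ if $|A|=3$ and $a<b<c<d$ if $|A|=4$; in particular $i'\in\{j,y(j)\}$ and $j'\in\{i,y(i)\}$. $$\begin{array}{|c|c|c|c|c|c|} \hline [y]_A & [w]_A & (i,j) & (i',j') & i' & j' \\ \hline 321 & 231 & (a,b) & (b,c) & j & y(i) \\ 321 & 312 & (b,c) & (a,b) & y(j) & i \\ \hline 4321 & 2431 & (a,b) & (c,d) & y(j) & y(i) \\ 4321 & 2431 & (a,c) & (c,d) & j & y(i) \\ 4321 & 3412 &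 (a,b) & (b,d) & j & y(i) \\ 4321 & 3412 & (c,d) & (a,c) & y(j) & i \\ 4321 & 4213 & (b,d) & (a,b) & y(j) & i \\ 4321 & 4213 & (c,d) & (a,b) & y(j) & y(i) \\ \hline \end{array}$$ -/

import Mathlib

namespace InvAtoms

/-- The group of permutations of the integers that fix all but finitely many points. -/
def SZ : Subgroup (Equiv.Perm ℤ) where
  carrier := {w | {i : ℤ | w i ≠ i}.Finite}
  one_mem' := by simp
  mul_mem' := by
    intro u v hu hv
    refine (Set.Finite.union hu hv).subset ?_
    intro i hi
    by_contra h
    simp only [Set.mem_union, Set.mem_ofPred_eq, not_or, not_not] at h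
    exact hi (by simp [Equiv.Perm.mul_apply, h.1, h.2])
  inv_mem' := by
    intro u hu
    refine Set.Finite.subset hu ?_
    intro i hi h
    exact hi (by rw [Equiv.Perm.inv_eq_iff_eq]; exact h.symm)

/-- The transposition `(a, b)` as an element of `SZ` (the identity if `a = b`). -/
def tr (a b : ℤ) : SZ :=
  ⟨Equiv.swap a b, by
    refine Set.Finite.subset (Set.toFinite ({a, b} : Set ℤ)) ?_
    intro i hi
    by_contra h
    simp only [Set.mem_insert_iff, Set.mem_singleton_iff, not_or] at h
    exact hi (Equiv.swap_apply_of_ne_of_ne h.1 h.2)⟩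

/-- The simple transposition `(i, i + 1)`. -/
def simple (i : ℤ) : SZ := tr i (i + 1)

/-- The inversion set of a permutation. -/
def inversions (w : SZ) : Set (ℤ × ℤ) :=
  {p | p.1 < p.2 ∧ w.1 p.2 < w.1 p.1}

/-- The length of a permutation: its number of inversions. -/
noncomputable def len (w : SZ) : ℕ := (inversions w).ncard

/-- The (strict, strong) Bruhat order: the weakest transitive relation with `w < w t`
whenever `t` is a transposition and `w t` is longer than `w`. -/
def bruhatLT : SZ → SZ → Prop :=
  Relation.TransGen (fun u v => ∃ a b : ℤ, a < b ∧ v = u * tr a b ∧ len u < len v)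

/-- The covering relation of the Bruhat order: `{u} = {x | u ≤ x < v}`. -/
def bruhatCovers (u v : SZ) : Prop :=
  {x : SZ | (x = u ∨ bruhatLT u x) ∧ bruhatLT x v} = {u}

/-- The characterization of the Demazure product on `SZ`. -/
structure IsDemazureProduct (m : SZ → SZ → SZ) : Prop where
  assoc : ∀ u v w, m (m u v) w = m u (m v w)
  eq_mul : ∀ u v, len (u * v) = len u + len v → m u v = u * v
  simple_simple : ∀ i, m (simple i) (simple i) = simple i

/-! ### Existence and uniqueness of the Demazure product -/

theorem simple_apply (i a : ℤ) :
    (simple i).1 a = if a = i then i + 1 else if a = i + 1 then i else a := by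
  simp [simple, tr, Equiv.swap_apply_def]

theorem mul_simple_apply (w : SZ) (i a : ℤ) :
    (w * simple i).1 a = w.1 (if a = i then i + 1 else if a = i + 1 then i else a) := by
  rw [← simple_apply]; rfl

theorem simple_mul_simple (i : ℤ) : simple i * simple i = 1 := by
  apply Subtype.ext
  simp [simple, tr]

theorem simple_inv (i : ℤ) : (simple i)⁻¹ = simple i :=
  inv_eq_of_mul_eq_one_left (simple_mul_simple i)

theorem mul_simple_mul_simple (w : SZ) (i : ℤ) : w * simple i * simple i = w := by
  rw [mul_assoc, simple_mul_simple, mul_one]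

theorem inversions_finite (w : SZ) : (inversions w).Finite := by
  have hw : {i : ℤ | w.1 i ≠ i}.Finite := w.2
  obtain ⟨N, hN⟩ := hw.bddAbove
  obtain ⟨M, hM⟩ := hw.bddBelow
  have key : ∀ i, w.1 i ≠ i → (M ≤ i ∧ i ≤ N) ∧ M ≤ w.1 i ∧ w.1 i ≤ N := by
    intro i hi
    have h2 : w.1 (w.1 i) ≠ w.1 i := fun h => hi (w.1.injective h)
    exact ⟨⟨hM hi, hN hi⟩, hM h2, hN h2⟩
  refine ((Set.finite_Icc M N).prod (Set.finite_Icc M N)).subset ?_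
  rintro ⟨a, b⟩ ⟨h1, h2⟩
  simp only at h1 h2
  have ha := key a
  have hb := key b
  simp only [Set.mem_prod, Set.mem_Icc]
  by_cases h : w.1 a = a
  · by_cases h' : w.1 b = b
    · omega
    · have := hb h'
      omega
  · have := ha h
    by_cases h' : w.1 b = b
    · omega
    · have := hb h'
      omega

theorem len_one : len 1 = 0 := by
  have : inversions 1 = ∅ := by
    ext p
    simp only [inversions, Set.mem_ofPred_eq, Set.mem_empty_iff_false, iff_false]
    rintro ⟨h1, h2⟩
    have h2' : p.2 < p.1 := h2
    omega
  simp [len, this]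

theorem len_mul_simple_of_lt (w : SZ) (i : ℤ) (h : w.1 i < w.1 (i + 1)) :
    len (w * simple i) = len w + 1 := by
  have hinj : Function.Injective (Prod.map (simple i).1 (simple i).1) :=
    Function.Injective.prodMap (simple i).1.injective (simple i).1.injective
  have hsurj : Function.Surjective (Prod.map (simple i).1 (simple i).1) :=
    Function.Surjective.prodMap (simple i).1.surjective (simple i).1.surjective
  have key : inversions (w * simple i)
      = insert (i, i + 1) (Prod.map (simple i).1 (simple i).1 ⁻¹' inversions w) := by
    ext ⟨a, b⟩
    simp only [inversions, Set.mem_ofPred_eq, Set.mem_insert_iff, Set.mem_preimage, Prod.map_apply,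
      mul_simple_apply, simple_apply, Prod.mk.injEq]
    by_cases h1 : a = i
    · by_cases h2 : b = i + 1
      · subst h1 h2; simp [h]
      · by_cases h3 : b = i
        · subst h1 h3; simp
        · simp only [h1, h2, h3]; simp; intro _; omega
    · by_cases h2 : a = i + 1
      · by_cases h3 : b = i
        · subst h2 h3; simp; omega
        · by_cases h4 : b = i + 1
          · simp [h2, h4]
          · simp only [h2, h3, h4]; simp; intro _; omega
      · by_cases h3 : b = i
        · simp only [h1, h2, h3]; simp; intro _; omega
        · by_cases h4 : b = i + 1
          · simp only [h1, h2, h4]; simp; intro _; omega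
          · simp [h1, h2, h3, h4]
  have hnot : (i, i + 1) ∉ Prod.map (simple i).1 (simple i).1 ⁻¹' inversions w := by
    simp [inversions, simple_apply]
  have hcard : (Prod.map (simple i).1 (simple i).1 ⁻¹' inversions w).ncard
      = (inversions w).ncard :=
    Set.ncard_preimage_of_injective_subset_range hinj (by simp [hsurj.range_eq])
  have hfin : (Prod.map (simple i).1 (simple i).1 ⁻¹' inversions w).Finite :=
    (inversions_finite w).preimage hinj.injOn
  rw [len, key, Set.ncard_insert_of_notMem hnot hfin, hcard, len]

theorem apply_succ_lt (w : SZ) (i : ℤ) (h : ¬ w.1 i < w.1 (i + 1)) : w.1 (i + 1) < w.1 i := by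
  have : w.1 i ≠ w.1 (i + 1) := fun h => by have := w.1.injective h; omega
  omega

theorem len_mul_simple_of_not_lt (w : SZ) (i : ℤ) (h : ¬ w.1 i < w.1 (i + 1)) :
    len (w * simple i) + 1 = len w := by
  have h1 := apply_succ_lt w i h
  have h2 := len_mul_simple_of_lt (w * simple i) i (by rw [mul_simple_apply, mul_simple_apply]; simp [h1])
  rw [mul_simple_mul_simple] at h2
  exact h2.symm

theorem exists_descent (w : SZ) (hw : w ≠ 1) : ∃ i : ℤ, ¬ w.1 i < w.1 (i + 1) := by
  by_contra! hc
  apply hw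
  have hm : StrictMono w.1 := strictMono_int_of_lt_succ hc
  have hfin : {i : ℤ | w.1 i ≠ i}.Finite := w.2
  have horb : ∀ i, w.1 i = i := by
    intro i
    by_contra hi
    rcases lt_or_gt_of_ne hi with h | h
    · obtain ⟨M, hM⟩ := hfin.bddBelow
      have h1 : ∀ n : ℕ, w.1 (i - n) ≤ i - n - 1 := by
        intro n
        induction n with
        | zero => simp; omega
        | succ n ih =>
          have := hm (show i - ((n + 1 : ℕ) : ℤ) < i - n by push_cast; omega)
          push_cast at *; omega
      have h2 := h1 (i - M + 1).toNat
      have h3 : M ≤ i - ((i - M + 1).toNat : ℤ) := hM (by simp only [Set.mem_ofPred_eq]; omega)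
      omega
    · obtain ⟨N, hN⟩ := hfin.bddAbove
      have h1 : ∀ n : ℕ, i + n + 1 ≤ w.1 (i + n) := by
        intro n
        induction n with
        | zero => simp; omega
        | succ n ih =>
          have := hm (show i + (n : ℤ) < i + ((n + 1 : ℕ) : ℤ) by push_cast; omega)
          push_cast at *; omega
      have h2 := h1 (N - i + 1).toNat
      have h3 : i + ((N - i + 1).toNat : ℤ) ≤ N := hN (by simp only [Set.mem_ofPred_eq]; omega)
      omega
  exact Subtype.ext (Equiv.ext horb)

/-- Induction on permutations by multiplying on the right by simple transpositions that
increase the length. -/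
theorem right_induction {P : SZ → Prop} (h1 : P 1)
    (hs : ∀ (v : SZ) (i : ℤ), v.1 i < v.1 (i + 1) → P v → P (v * simple i)) (v : SZ) : P v := by
  induction hn : len v using Nat.strong_induction_on generalizing v with
  | _ n ih =>
    by_cases hv : v = 1
    · rw [hv]; exact h1
    · obtain ⟨i, hi⟩ := exists_descent v hv
      have h2 := len_mul_simple_of_not_lt v i hi
      have h3 := apply_succ_lt v i hi
      have h4 := hs (v * simple i) i (by rw [mul_simple_apply, mul_simple_apply]; simp [h3])
        (ih _ (by omega) _ rfl)
      rwa [mul_simple_mul_simple] at h4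

theorem len_mul_le (u v : SZ) : len (u * v) ≤ len u + len v := by
  induction v using right_induction with
  | h1 => simp [len_one]
  | hs v i hi ih =>
    rw [← mul_assoc, len_mul_simple_of_lt v i hi]
    by_cases h : (u * v).1 i < (u * v).1 (i + 1)
    · rw [len_mul_simple_of_lt _ i h]; omega
    · have := len_mul_simple_of_not_lt _ i h; omega

theorem len_simple (i : ℤ) : len (simple i) = 1 := by
  have := len_mul_simple_of_lt 1 i (by simp)
  rwa [one_mul, len_one] at this

/-- The right Demazure action of a simple transposition. -/
def rightAct (i : ℤ) (u : SZ) : SZ := if u.1 i < u.1 (i + 1) then u * simple i else u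

/-- The left Demazure action of a simple transposition. -/
def leftAct (i : ℤ) (u : SZ) : SZ := (rightAct i u⁻¹)⁻¹

theorem leftAct_eq (i : ℤ) (u : SZ) :
    leftAct i u = if u.1.symm i < u.1.symm (i + 1) then simple i * u else u := by
  have h : (u⁻¹ : SZ).1 = u.1.symm := rfl
  simp only [leftAct, rightAct, h]
  split_ifs
  · rw [mul_inv_rev, inv_inv, simple_inv]
  · rw [inv_inv]

theorem leftAct_rightAct (i j : ℤ) (u : SZ) :
    leftAct i (rightAct j u) = rightAct j (leftAct i u) := by
  have hR : ∀ a, (u * simple j).1.symm a = (simple j).1 (u.1.symm a) := by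
    intro a
    rw [Equiv.symm_apply_eq]
    change a = u.1 ((simple j).1 ((simple j).1 (u.1.symm a)))
    simp [simple, tr]
  have hL : ∀ a, (simple i * u).1 a = (simple i).1 (u.1 a) := fun a => rfl
  obtain ⟨p, hp⟩ : ∃ p, u.1.symm i = p := ⟨_, rfl⟩
  obtain ⟨q, hq⟩ : ∃ q, u.1.symm (i + 1) = q := ⟨_, rfl⟩
  have hup : u.1 p = i := by rw [← hp]; simp
  have huq : u.1 q = i + 1 := by rw [← hq]; simp
  have hpq : p ≠ q := by rintro rfl; omega
  by_cases hex : (p = j ∧ q = j + 1) ∨ (p = j + 1 ∧ q = j)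
  · have hcomm : simple i * u = u * simple j := by
      apply Subtype.ext
      ext a
      rw [hL, mul_simple_apply, simple_apply]
      have e1 : u.1 a = i ↔ a = p := by rw [← hup]; exact u.1.injective.eq_iff
      have e2 : u.1 a = i + 1 ↔ a = q := by rw [← huq]; exact u.1.injective.eq_iff
      simp only [e1, e2]
      rcases hex with ⟨h1, h2⟩ | ⟨h1, h2⟩
      · subst h1 h2
        split_ifs <;> simp_all
      · subst h1 h2
        split_ifs <;> simp_all
    rcases hex with ⟨h1, h2⟩ | ⟨h1, h2⟩
    · subst h1 h2
      have d1 : ¬ (u * simple p).1.symm i < (u * simple p).1.symm (i + 1) := by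
        rw [hR, hR, hp, hq]; simp [simple_apply]
      have d2 : ¬ (u * simple p).1 p < (u * simple p).1 (p + 1) := by
        rw [mul_simple_apply, mul_simple_apply]; simp [hup, huq]
      have d3 : i < i + 1 := by omega
      have d4 : p < p + 1 := by omega
      simp only [leftAct_eq, rightAct, hup, huq, hp, hq, d3, d4, hcomm, if_true, d1, d2, if_false]
    · subst h1 h2
      simp only [leftAct_eq, rightAct, hup, huq, hp, hq]
      simp [hp, hq, hup, huq]
  · have c1 : ((simple j).1 p < (simple j).1 q) ↔ p < q := by
      simp only [simple_apply]; split_ifs <;> omega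
    obtain ⟨x, hx⟩ : ∃ x, u.1 j = x := ⟨_, rfl⟩
    obtain ⟨z, hz⟩ : ∃ z, u.1 (j + 1) = z := ⟨_, rfl⟩
    have e1 : x = i ↔ j = p := by rw [← hup, ← hx]; exact u.1.injective.eq_iff
    have e2 : x = i + 1 ↔ j = q := by rw [← huq, ← hx]; exact u.1.injective.eq_iff
    have e3 : z = i ↔ j + 1 = p := by rw [← hup, ← hz]; exact u.1.injective.eq_iff
    have e4 : z = i + 1 ↔ j + 1 = q := by rw [← huq, ← hz]; exact u.1.injective.eq_iff
    have c2 : ((simple i).1 x < (simple i).1 z) ↔ x < z := by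
      simp only [simple_apply]; split_ifs <;> omega
    simp only [leftAct_eq, rightAct]
    by_cases ha : x < z <;> by_cases hb : p < q <;>
      simp only [hL, hR, hp, hq, hx, hz, c1, c2, ha, hb, if_true, if_false, mul_assoc]

/-- The maps obtained by composing right Demazure actions of simple transpositions. -/
inductive IsRightAct : (SZ → SZ) → Prop
  | one : IsRightAct id
  | step (f : SZ → SZ) (i : ℤ) : IsRightAct f → IsRightAct (rightAct i ∘ f)

theorem IsRightAct.comp {f g : SZ → SZ} (hg : IsRightAct g) (hf : IsRightAct f) :
    IsRightAct (g ∘ f) := by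
  induction hg with
  | one => exact hf
  | step g i _ ih => exact IsRightAct.step _ i ih

theorem IsRightAct.commute {f : SZ → SZ} (hf : IsRightAct f) (i : ℤ) (u : SZ) :
    f (leftAct i u) = leftAct i (f u) := by
  induction hf with
  | one => rfl
  | step f j _ ih => simp only [Function.comp_apply]; rw [ih, leftAct_rightAct]

theorem left_induction {P : SZ → Prop} (h1 : P 1)
    (hs : ∀ (v : SZ) (i : ℤ), P v → P (leftAct i v)) (v : SZ) : P v := by
  have key : ∀ v : SZ, P v⁻¹ := by
    intro v
    induction v using right_induction with
    | h1 => simpa using h1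
    | hs v i hi ih =>
      have := hs _ i ih
      rwa [leftAct, inv_inv, rightAct, if_pos hi] at this
  simpa using key v⁻¹

theorem IsRightAct.ext_one {f g : SZ → SZ} (hf : IsRightAct f) (hg : IsRightAct g)
    (h : f 1 = g 1) : f = g := by
  funext u
  induction u using left_induction with
  | h1 => exact h
  | hs v i ih => rw [hf.commute, hg.commute, ih]

theorem exists_isRightAct (v : SZ) : ∃ f, IsRightAct f ∧ f 1 = v := by
  induction v using right_induction with
  | h1 => exact ⟨id, .one, rfl⟩
  | hs v i hi ih =>
    obtain ⟨f, hf, hv⟩ := ih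
    exact ⟨_, .step f i hf, by simp [hv, rightAct, hi]⟩

theorem exists_isDemazureProduct : ∃ m, IsDemazureProduct m := by
  choose F hF hF1 using exists_isRightAct
  have hF_mul : ∀ v i, v.1 i < v.1 (i + 1) → F (v * simple i) = rightAct i ∘ F v := by
    intro v i hi
    exact (hF _).ext_one (.step _ i (hF v)) (by simp [hF1, rightAct, hi])
  have hFone : F 1 = id := (hF 1).ext_one .one (by simp [hF1])
  refine ⟨fun u v => F v u, ?_, ?_, ?_⟩
  · intro u v w
    have : F (F w v) = F w ∘ F v := (hF _).ext_one ((hF w).comp (hF v)) (by simp [hF1])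
    simp [this]
  · intro u v
    induction v using right_induction with
    | h1 => simp [hFone]
    | hs v i hi ih =>
      intro h
      rw [← mul_assoc, len_mul_simple_of_lt v i hi] at h
      have hle := len_mul_le u v
      have hup : (u * v).1 i < (u * v).1 (i + 1) := by
        by_contra hc
        have := len_mul_simple_of_not_lt _ i hc
        omega
      rw [len_mul_simple_of_lt _ i hup] at h
      rw [hF_mul v i hi, Function.comp_apply, ih (by omega), rightAct, if_pos hup, mul_assoc]
  · intro i
    have h1 := hF_mul 1 i (by simp)
    rw [one_mul] at h1
    simp [h1, hFone, rightAct, simple_apply]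

theorem IsDemazureProduct.apply_simple {m : SZ → SZ → SZ} (hm : IsDemazureProduct m)
    (u : SZ) (i : ℤ) : m u (simple i) = rightAct i u := by
  rw [rightAct]
  split_ifs with h
  · exact hm.eq_mul _ _ (by rw [len_mul_simple_of_lt u i h, len_simple])
  · have h1 := len_mul_simple_of_not_lt u i h
    have h2 : m (u * simple i) (simple i) = u := by
      rw [hm.eq_mul _ _ (by rw [mul_simple_mul_simple, len_simple, h1]), mul_simple_mul_simple]
    calc m u (simple i) = m (m (u * simple i) (simple i)) (simple i) := by rw [h2]
      _ = u := by rw [hm.assoc, hm.simple_simple, h2]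

theorem IsDemazureProduct.unique {m m' : SZ → SZ → SZ} (hm : IsDemazureProduct m)
    (hm' : IsDemazureProduct m') : m = m' := by
  funext u v
  induction v using right_induction generalizing u with
  | h1 => rw [hm.eq_mul u 1 (by simp [len_one]), hm'.eq_mul u 1 (by simp [len_one])]
  | hs v i hi ih =>
    have h : v * simple i = rightAct i v := by rw [rightAct, if_pos hi]
    calc m u (v * simple i) = m (m u v) (simple i) := by
          rw [hm.assoc, hm.apply_simple, h]
      _ = m' (m' u v) (simple i) := by rw [ih, hm.apply_simple, hm'.apply_simple]
      _ = m' u (v * simple i) := by rw [hm'.assoc, hm'.apply_simple, h]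

theorem existsUnique_demazure : ∃! m, IsDemazureProduct m := by
  obtain ⟨m, hm⟩ := exists_isDemazureProduct
  exact ⟨m, hm, fun _ h => h.unique hm⟩

/-! ### Atoms, flattening and the table -/

/-- The Demazure product on `SZ`. -/
noncomputable def demazure : SZ → SZ → SZ := Classical.choose existsUnique_demazure.exists

theorem isDemazureProduct_demazure : IsDemazureProduct demazure :=
  Classical.choose_spec existsUnique_demazure.exists

/-- Involutions: the elements `y = y⁻¹` (the identity included). -/
def IsInvolution (y : SZ) : Prop := y = y⁻¹

/-- The atoms of `y`: the elements `w` of minimal length with `y = w⁻¹ ∘ w`, where `∘` is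
the Demazure product. -/
def atoms (y : SZ) : Set SZ :=
  {w | y = demazure w⁻¹ w ∧ ∀ v : SZ, y = demazure v⁻¹ v → len w ≤ len v}

/-- The flattening of `w` on a finite set `E` of size `n`: the permutation `ψ ∘ w ∘ φ`, with `φ`
the increasing bijection from the first `n` numbers to `E` and `ψ` the increasing bijection from
`w(E)` to the first `n` numbers. Here the first `n` numbers are `0, …, n - 1`. -/
def flatten (w : SZ) (E : Finset ℤ) : Equiv.Perm (Fin E.card) :=
  ((E.orderIsoOfFin rfl).toEquiv.trans (w.1.subtypeEquiv (fun a => by simp))).trans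
    ((E.map w.1.toEmbedding).orderIsoOfFin (Finset.card_map _)).toEquiv.symm

/-- One-line notation of a permutation, as a list with entries `1, …, n`. -/
def oneLine {n : ℕ} (u : Equiv.Perm (Fin n)) : List ℕ := List.ofFn (fun k => (u k : ℕ) + 1)

/-- The set `{i, j, y(i), y(j)}`. -/
def orbitSet (y : SZ) (i j : ℤ) : Finset ℤ := {i, j, y.1 i, y.1 j}

/-- The data `(y, w, i, j, i', j')` match one of the eight rows of the table.
The columns of the table are: a labeling of `A = {i, j, y(i), y(j)}` in increasing order, the
flattenings of `y` and of `w` on `A`, the pair `(i, j)` and the pair `(i', j')` in this labeling,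
and the numbers `i'` and `j'` in terms of `i`, `j` and `y`. -/
def MatchesTable (y w : SZ) (i j i' j' : ℤ) : Prop :=
  let A := orbitSet y i j
  (∃ a b c : ℤ, a < b ∧ b < c ∧ A = {a, b, c} ∧ oneLine (flatten y A) = [3, 2, 1] ∧
    ((oneLine (flatten w A) = [2, 3, 1] ∧
        (i, j) = (a, b) ∧ (i', j') = (b, c) ∧ i' = j ∧ j' = y.1 i) ∨
     (oneLine (flatten w A) = [3, 1, 2] ∧
        (i, j) = (b, c) ∧ (i', j') = (a, b) ∧ i' = y.1 j ∧ j' = i))) ∨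
  (∃ a b c d : ℤ, a < b ∧ b < c ∧ c < d ∧ A = {a, b, c, d} ∧
    oneLine (flatten y A) = [4, 3, 2, 1] ∧
    ((oneLine (flatten w A) = [2, 4, 3, 1] ∧
        (i, j) = (a, b) ∧ (i', j') = (c, d) ∧ i' = y.1 j ∧ j' = y.1 i) ∨
     (oneLine (flatten w A) = [2, 4, 3, 1] ∧
        (i, j) = (a, c) ∧ (i', j') = (c, d) ∧ i' = j ∧ j' = y.1 i) ∨
     (oneLine (flatten w A) = [3, 4, 1, 2] ∧
        (i, j) = (a, b) ∧ (i', j') = (b, d) ∧ i' = j ∧ j' = y.1 i) ∨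
     (oneLine (flatten w A) = [3, 4, 1, 2] ∧
        (i, j) = (c, d) ∧ (i', j') = (a, c) ∧ i' = y.1 j ∧ j' = i) ∨
     (oneLine (flatten w A) = [4, 2, 1, 3] ∧
        (i, j) = (b, d) ∧ (i', j') = (a, b) ∧ i' = y.1 j ∧ j' = i) ∨
     (oneLine (flatten w A) = [4, 2, 1, 3] ∧
        (i, j) = (c, d) ∧ (i', j') = (a, b) ∧ i' = y.1 j ∧ j' = y.1 i)))

end InvAtoms

open InvAtoms

namespace InvAtoms

/-! ### Lengths -/

theorem inv_apply_eq (w : SZ) (a : ℤ) : (w⁻¹ : SZ).1 a = w.1.symm a := rfl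

theorem mul_apply (u v : SZ) (a : ℤ) : (u * v).1 a = u.1 (v.1 a) := rfl

theorem tr_apply (a b x : ℤ) : (tr a b).1 x = if x = a then b else if x = b then a else x := by
  simp [tr, Equiv.swap_apply_def]

theorem tr_mul_tr (a b : ℤ) : tr a b * tr a b = 1 := by
  apply Subtype.ext
  simp [tr]

theorem len_inv (w : SZ) : len w⁻¹ = len w := by
  have h : inversions w⁻¹ = (fun p : ℤ × ℤ => (w.1 p.2, w.1 p.1)) '' inversions w := by
    ext ⟨a, b⟩
    simp only [inversions, Set.mem_ofPred_eq, inv_apply_eq, Set.mem_image, Prod.mk.injEq,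
      Prod.exists]
    constructor
    · rintro ⟨h1, h2⟩
      exact ⟨_, _, ⟨h2, by simpa using h1⟩, by simp, by simp⟩
    · rintro ⟨p, q, ⟨h1, h2⟩, rfl, rfl⟩
      simpa using ⟨h2, h1⟩
  rw [len, h, Set.ncard_image_of_injective, len]
  rintro ⟨a, b⟩ ⟨c, d⟩ h
  simp only [Prod.mk.injEq, EmbeddingLike.apply_eq_iff_eq] at h
  simp [h]

theorem len_lt_len_mul_tr (w : SZ) {i j : ℤ} (hij : i < j) (h : w.1 i < w.1 j) :
    len w < len (w * tr i j) := by
  obtain ⟨t, ht⟩ : ∃ t : ℤ → ℤ, t = fun x => (tr i j).1 x := ⟨_, rfl⟩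
  have hti : ∀ x, t x = if x = i then j else if x = j then i else x := by
    intro x; rw [ht]; exact tr_apply i j x
  have htt : ∀ x, t (t x) = x := by
    intro x; simp only [hti]; split_ifs <;> simp_all
  have hwt : ∀ x, (w * tr i j).1 x = w.1 (t x) := fun x => by rw [ht]; rfl
  let f : ℤ × ℤ → ℤ × ℤ := fun p => if t p.1 < t p.2 then (t p.1, t p.2) else p
  have hinj : Set.InjOn f (inversions w) := by
    rintro ⟨p, q⟩ ⟨h1, -⟩ ⟨p', q'⟩ ⟨h1', -⟩ he
    simp only at h1 h1'
    simp only [f] at he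
    split_ifs at he with c1 c2 c2
    · simp only [Prod.mk.injEq] at he ⊢
      exact ⟨by rw [← htt p, he.1, htt], by rw [← htt q, he.2, htt]⟩
    · simp only [Prod.mk.injEq] at he
      rw [← he.1, ← he.2, htt, htt] at c2
      exact absurd h1 c2
    · simp only [Prod.mk.injEq] at he
      rw [he.1, he.2, htt, htt] at c1
      exact absurd h1' c1
    · exact he
  have hmaps : f '' inversions w ⊆ inversions (w * tr i j) := by
    rintro _ ⟨⟨p, q⟩, ⟨h1, h2⟩, rfl⟩
    simp only at h1 h2
    simp only [f]
    split_ifs with c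
    · exact ⟨c, by simpa only [hwt, htt] using h2⟩
    · refine ⟨h1, ?_⟩
      simp only [hwt]
      rw [hti, hti] at c ⊢
      split_ifs at c ⊢ <;> subst_vars <;> omega
  have hnot : (i, j) ∉ f '' inversions w := by
    rintro ⟨⟨p, q⟩, ⟨h1, h2⟩, he⟩
    simp only at h1 h2
    simp only [f] at he
    split_ifs at he with c
    · simp only [Prod.mk.injEq] at he
      have e1 : p = j := by rw [← htt p, he.1, hti]; simp
      have e2 : q = i := by rw [← htt q, he.2, hti]; split_ifs <;> simp_all
      omega
    · simp only [Prod.mk.injEq] at he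
      rw [he.1, he.2] at h2
      omega
  have hmem : (i, j) ∈ inversions (w * tr i j) := by
    refine ⟨hij, ?_⟩
    simp only [hwt, hti]
    split_ifs <;> simp_all
  have hss : f '' inversions w ⊂ inversions (w * tr i j) :=
    (Set.ssubset_iff_of_subset hmaps).2 ⟨_, hmem, hnot⟩
  have := Set.ncard_lt_ncard hss (inversions_finite _)
  rwa [hinj.ncard_image] at this

/-! ### Bruhat covers -/

theorem bruhatLT.len_lt {u v : SZ} (h : bruhatLT u v) : len u < len v := by
  induction h with
  | single h => obtain ⟨_, _, _, _, h⟩ := h; exact h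
  | tail _ h ih => obtain ⟨_, _, _, _, h⟩ := h; exact ih.trans h

theorem bruhatLT_mul_tr (w : SZ) {i j : ℤ} (hij : i < j) (h : w.1 i < w.1 j) :
    bruhatLT w (w * tr i j) :=
  .single ⟨i, j, hij, rfl, len_lt_len_mul_tr w hij h⟩

theorem bruhatCovers.apply_lt {w : SZ} {i j : ℤ} (hij : i < j)
    (h : bruhatCovers w (w * tr i j)) : w.1 i < w.1 j := by
  have hw : bruhatLT w (w * tr i j) := by
    have : w ∈ {x : SZ | (x = w ∨ bruhatLT w x) ∧ bruhatLT x (w * tr i j)} := by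
      rw [show {x : SZ | (x = w ∨ bruhatLT w x) ∧ bruhatLT x (w * tr i j)} = {w} from h]
      rfl
    exact this.2
  by_contra hc
  have hne : w.1 i ≠ w.1 j := fun he => hij.ne (w.1.injective he)
  have h1 : (w * tr i j).1 i < (w * tr i j).1 j := by
    simp only [mul_apply, tr_apply, if_true, hij.ne', if_false]
    omega
  have h2 := len_lt_len_mul_tr _ hij h1
  rw [mul_assoc, tr_mul_tr, mul_one] at h2
  exact absurd hw.len_lt (by omega)

theorem bruhatCovers.not_between {w : SZ} {i j : ℤ}
    (h : bruhatCovers w (w * tr i j)) {e : ℤ} (h1 : i < e) (h2 : e < j) :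
    w.1 e < w.1 i ∨ w.1 j < w.1 e := by
  by_contra! hc
  have hi : w.1 i ≠ w.1 e := fun he => h1.ne (w.1.injective he)
  have hj : w.1 e ≠ w.1 j := fun he => h2.ne (w.1.injective he)
  have a1 : bruhatLT w (w * tr i e) := bruhatLT_mul_tr w h1 (by omega)
  have a2 : bruhatLT (w * tr i e) (w * tr i e * tr e j) := by
    apply bruhatLT_mul_tr _ h2
    simp only [mul_apply, tr_apply]
    split_ifs <;> omega
  have a3 : bruhatLT (w * tr i e * tr e j) (w * tr i e * tr e j * tr i e) := by
    apply bruhatLT_mul_tr _ h1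
    simp only [mul_apply, tr_apply]
    split_ifs <;> omega
  have he : w * tr i e * tr e j * tr i e = w * tr i j := by
    simp only [mul_assoc]
    congr 1
    apply Subtype.ext
    ext x
    simp only [mul_apply, tr_apply]
    split_ifs <;> omega
  rw [he] at a3
  have hmem : w * tr i e ∈ {x : SZ | (x = w ∨ bruhatLT w x) ∧ bruhatLT x (w * tr i j)} :=
    ⟨.inr a1, a2.trans a3⟩
  rw [show {x : SZ | (x = w ∨ bruhatLT w x) ∧ bruhatLT x (w * tr i j)} = {w} from h] at hmem
  have := a1.len_lt
  rw [show w * tr i e = w from hmem] at this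
  omega

/-! ### The Demazure conjugation action on involutions -/

/-- The map `y ↦ s ∘ y ∘ s` for `s = (i, i + 1)`. -/
def demazureConj (i : ℤ) (y : SZ) : SZ := leftAct i (rightAct i y)

theorem IsDemazureProduct.simple_apply {m : SZ → SZ → SZ} (hm : IsDemazureProduct m)
    (u : SZ) (i : ℤ) : m (simple i) u = leftAct i u := by
  have hl : ∀ v : SZ, len (simple i * v) = len (v⁻¹ * simple i) := by
    intro v
    rw [← len_inv, mul_inv_rev, simple_inv]
  rw [leftAct_eq]
  split_ifs with h
  · apply hm.eq_mul
    rw [hl, len_mul_simple_of_lt _ _ h, len_simple, len_inv, add_comm]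
  · have h1 := len_mul_simple_of_not_lt u⁻¹ i h
    rw [← hl, len_inv] at h1
    have h3 : simple i * (simple i * u) = u := by rw [← mul_assoc, simple_mul_simple, one_mul]
    have h2 : m (simple i) (simple i * u) = u := by
      rw [hm.eq_mul _ _ (by rw [h3, len_simple]; omega), h3]
    calc m (simple i) u = m (simple i) (m (simple i) (simple i * u)) := by rw [h2]
      _ = u := by rw [← hm.assoc, hm.simple_simple, h2]

/-- The Demazure product `w⁻¹ ∘ w`. -/
noncomputable def demazureSquare (w : SZ) : SZ := demazure w⁻¹ w

theorem demazureSquare_one : demazureSquare 1 = 1 := by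
  rw [demazureSquare, isDemazureProduct_demazure.eq_mul _ _ (by simp [len_one])]
  simp

theorem demazureSquare_mul_simple {w : SZ} {i : ℤ} (h : w.1 i < w.1 (i + 1)) :
    demazureSquare (w * simple i) = demazureConj i (demazureSquare w) := by
  have hm := isDemazureProduct_demazure
  have h1 : w * simple i = demazure w (simple i) := by rw [hm.apply_simple, rightAct, if_pos h]
  have h2 : (w * simple i)⁻¹ = demazure (simple i) w⁻¹ := by
    rw [hm.simple_apply, leftAct, inv_inv, rightAct, if_pos h]
  rw [demazureSquare, h2, h1, demazureConj, ← hm.apply_simple, ← hm.simple_apply, demazureSquare,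
    hm.assoc, hm.assoc]

theorem IsInvolution.apply_apply {y : SZ} (hy : IsInvolution y) (a : ℤ) : y.1 (y.1 a) = a := by
  have : y.1.symm (y.1 a) = a := y.1.symm_apply_apply a
  rw [← inv_apply_eq, ← hy] at this
  exact this

theorem isInvolution_of_apply_apply {y : SZ} (h : ∀ a, y.1 (y.1 a) = a) : IsInvolution y := by
  apply Subtype.ext
  ext a
  rw [inv_apply_eq, Equiv.eq_symm_apply, h]

theorem IsInvolution.symm_apply {y : SZ} (hy : IsInvolution y) (a : ℤ) :
    y.1.symm a = y.1 a := by
  rw [Equiv.symm_apply_eq, hy.apply_apply]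

theorem demazureConj_of_not_lt {y : SZ} (hy : IsInvolution y) {i : ℤ}
    (h : ¬ y.1 i < y.1 (i + 1)) : demazureConj i y = y := by
  rw [demazureConj, rightAct, if_neg h, leftAct_eq, hy.symm_apply, hy.symm_apply, if_neg h]

theorem demazureConj_of_fixed {y : SZ} {i : ℤ}
    (h : y.1 i = i) (h' : y.1 (i + 1) = i + 1) : demazureConj i y = y * simple i := by
  have h1 : (y * simple i).1.symm i = i + 1 := by
    rw [Equiv.symm_apply_eq, mul_simple_apply]; simp [h]
  have h2 : (y * simple i).1.symm (i + 1) = i := by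
    rw [Equiv.symm_apply_eq, mul_simple_apply]; simp [h']
  rw [demazureConj, rightAct, if_pos (by omega), leftAct_eq, h1, h2, if_neg (by omega)]

theorem symm_mul_simple_apply (y : SZ) (i a : ℤ) :
    (y * simple i).1.symm a = (simple i).1 (y.1.symm a) := by
  rw [Equiv.symm_apply_eq]
  change a = y.1 ((simple i).1 ((simple i).1 (y.1.symm a)))
  simp [simple, tr]

theorem demazureConj_of_lt {y : SZ} (hy : IsInvolution y) {i : ℤ}
    (h : y.1 i < y.1 (i + 1)) (hf : ¬ (y.1 i = i ∧ y.1 (i + 1) = i + 1)) :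
    demazureConj i y = simple i * (y * simple i) := by
  rw [demazureConj, rightAct, if_pos h, leftAct_eq, if_pos]
  rw [symm_mul_simple_apply, symm_mul_simple_apply, hy.symm_apply, hy.symm_apply, simple_apply,
    simple_apply]
  split_ifs <;> omega

theorem IsInvolution.demazureConj {y : SZ} (hy : IsInvolution y) (i : ℤ) :
    IsInvolution (demazureConj i y) := by
  have hyy := hy.apply_apply
  by_cases h : y.1 i < y.1 (i + 1)
  · by_cases hf : y.1 i = i ∧ y.1 (i + 1) = i + 1
    · rw [demazureConj_of_fixed hf.1 hf.2]
      apply isInvolution_of_apply_apply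
      intro a
      have := hyy a
      simp only [mul_simple_apply]
      grind
    · rw [demazureConj_of_lt hy h hf]
      apply isInvolution_of_apply_apply
      intro a
      have hs : ∀ x, (simple i).1 ((simple i).1 x) = x := fun x => by simp [simple, tr]
      simp only [mul_apply, hs, hyy]
  · rwa [demazureConj_of_not_lt hy h]

theorem isInvolution_one : IsInvolution 1 := by simp [IsInvolution]

theorem isInvolution_demazureSquare (w : SZ) : IsInvolution (demazureSquare w) := by
  induction w using right_induction with
  | h1 => rw [demazureSquare_one]; exact isInvolution_one
  | hs v i hi ih => rw [demazureSquare_mul_simple hi]; exact ih.demazureConj i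

theorem not_lt_demazureConj {y : SZ} (hy : IsInvolution y) (i : ℤ) :
    ¬ (demazureConj i y).1 i < (demazureConj i y).1 (i + 1) := by
  by_cases h : y.1 i < y.1 (i + 1)
  · by_cases hf : y.1 i = i ∧ y.1 (i + 1) = i + 1
    · rw [demazureConj_of_fixed hf.1 hf.2]
      rw [mul_simple_apply, mul_simple_apply]
      simp [hf]
    · rw [demazureConj_of_lt hy h hf]
      have := hy.apply_apply i
      have := hy.apply_apply (i + 1)
      simp only [mul_apply, simple_apply]
      grind
  · rwa [demazureConj_of_not_lt hy h]

theorem finite_exceedances (y : SZ) : {a : ℤ | a < y.1 a}.Finite :=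
  Set.Finite.subset (show {a | y.1 a ≠ a}.Finite from y.2) fun _ h => (ne_of_lt h).symm

/-- Twice the length of the atoms of an involution. -/
noncomputable def involutionLen (y : SZ) : ℕ := len y + {a : ℤ | a < y.1 a}.ncard

theorem involutionLen_demazureConj {y : SZ} (hy : IsInvolution y) {i : ℤ}
    (h : y.1 i < y.1 (i + 1)) : involutionLen (demazureConj i y) = involutionLen y + 2 := by
  have h1 := len_mul_simple_of_lt y i h
  by_cases hf : y.1 i = i ∧ y.1 (i + 1) = i + 1
  · rw [demazureConj_of_fixed hf.1 hf.2]
    have : {a : ℤ | a < (y * simple i).1 a} = insert i {a : ℤ | a < y.1 a} := by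
      ext a
      simp only [Set.mem_ofPred_eq, Set.mem_insert_iff, mul_simple_apply]
      split_ifs with c1 c2
      · subst c1; simp [hf]
      · subst c2; simp [hf]
      · simp [c1]
    rw [involutionLen, this, Set.ncard_insert_of_notMem (by simp [hf]) (finite_exceedances y), h1,
      involutionLen]
    omega
  · rw [demazureConj_of_lt hy h hf]
    have hl : len (simple i * (y * simple i)) = len y + 2 := by
      rw [← len_inv, mul_inv_rev, simple_inv, len_mul_simple_of_lt, len_inv, h1]
      rw [inv_apply_eq, inv_apply_eq, symm_mul_simple_apply, symm_mul_simple_apply, hy.symm_apply,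
        hy.symm_apply, simple_apply, simple_apply]
      split_ifs <;> omega
    have : {a : ℤ | a < (simple i * (y * simple i)).1 a}
        = (simple i).1 ⁻¹' {a : ℤ | a < y.1 a} := by
      ext a
      simp only [Set.mem_ofPred_eq, Set.mem_preimage, mul_apply]
      have e1 := hy.apply_apply i
      have e2 := hy.apply_apply (i + 1)
      have e3 := hy.apply_apply a
      simp only [simple_apply]
      grind
    rw [involutionLen, hl, this, Set.ncard_preimage_of_injective_subset_range
      (simple i).1.injective (by simp [(simple i).1.surjective.range_eq]), involutionLen]
    omega

/-! ### The local description of atoms -/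

/-- The one-line description of the atoms `w` of an involution `y`: the two values of `w` on a
two-cycle of `y` form a descent, no value at a position inside the cycle lies between them, and
the values of `w` on two unnested cycles are in the same order as the cycles. -/
structure IsAtomPattern (y w : ℤ → ℤ) : Prop where
  swap : ∀ a, a < y a → w (y a) < w a
  inside : ∀ a e, a < e → e < y a → w e < w (y a) ∨ w a < w e
  mono : ∀ a a', a ≤ y a → a' ≤ y a' → a < a' → y a < y a' → w a < w (y a')

theorem IsAtomPattern.lt_of_unnested {y w : ℤ → ℤ} (h : IsAtomPattern y w)
    (hy : ∀ a, y (y a) = a) {p q : ℤ} (h1 : min p (y p) < min q (y q))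
    (h2 : max p (y p) < max q (y q)) : w p < w q := by
  have hp : ∃ a, a ≤ y a ∧ min p (y p) = a ∧ max p (y p) = y a ∧ w p ≤ w a := by
    have e := hy p
    rcases lt_trichotomy p (y p) with c | c | c
    · exact ⟨p, c.le, by omega, by omega, le_rfl⟩
    · exact ⟨p, c.le, by omega, by omega, le_rfl⟩
    · have := h.swap (y p)
      rw [e] at this
      exact ⟨y p, by omega, by omega, by omega, (this c).le⟩
  have hq : ∃ a, a ≤ y a ∧ min q (y q) = a ∧ max q (y q) = y a ∧ w (y a) ≤ w q := by
    have e := hy q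
    rcases lt_trichotomy q (y q) with c | c | c
    · exact ⟨q, c.le, by omega, by omega, (h.swap q c).le⟩
    · exact ⟨q, c.le, by omega, by omega, by rw [← c]⟩
    · exact ⟨y q, by omega, by omega, by omega, by rw [e]⟩
  obtain ⟨a, a1, a2, a3, a4⟩ := hp
  obtain ⟨b, b1, b2, b3, b4⟩ := hq
  have := h.mono a b a1 b1 (by omega) (by omega)
  omega

theorem IsAtomPattern.apply_succ_lt {y w : ℤ → ℤ} (h : IsAtomPattern y w)
    (hy : ∀ a, y (y a) = a) {i : ℤ} (hw : w (i + 1) < w i) : y (i + 1) < y i := by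
  have h1 := h.lt_of_unnested hy (p := i) (q := i + 1)
  have e1 := hy i
  have e2 := hy (i + 1)
  by_contra hc
  have : y i ≠ y (i + 1) := fun he => by rw [he, e2] at e1; omega
  omega

section

variable {y w s : ℤ → ℤ} {i : ℤ}

theorem lt_swap_succ_iff (hs : ∀ a, s a = if a = i then i + 1 else if a = i + 1 then i else a)
    (a b : ℤ) : s a < s b ↔ (a < b ∧ ¬ (a = i ∧ b = i + 1)) ∨ (a = i + 1 ∧ b = i) := by
  rw [hs, hs]; split_ifs <;> omega

theorem le_swap_succ_iff (hs : ∀ a, s a = if a = i then i + 1 else if a = i + 1 then i else a)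
    (a b : ℤ) : s a ≤ s b ↔ (a ≤ b ∧ ¬ (a = i ∧ b = i + 1)) ∨ (a = i + 1 ∧ b = i) := by
  rw [hs, hs]; split_ifs <;> omega

theorem swap_succ_swap_succ
    (hs : ∀ a, s a = if a = i then i + 1 else if a = i + 1 then i else a) (a : ℤ) :
    s (s a) = a := by
  simp only [hs]; split_ifs <;> omega

theorem IsAtomPattern.step (h : IsAtomPattern y w) (hy : ∀ a, y (y a) = a)
    (hs : ∀ a, s a = if a = i then i + 1 else if a = i + 1 then i else a)
    (h1 : y i < y (i + 1)) (h2 : ¬ (y i = i ∧ y (i + 1) = i + 1)) :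
    IsAtomPattern (fun a => s (y (s a))) (fun a => w (s a)) := by
  have hss := swap_succ_swap_succ hs
  refine ⟨fun a => ?_, fun a e => ?_, fun a a' => ?_⟩
  · obtain ⟨a, rfl⟩ : ∃ b, s b = a := ⟨s a, hss a⟩
    simp only [hss, lt_swap_succ_iff hs]
    rintro (⟨h3, -⟩ | ⟨rfl, h3⟩)
    · exact h.swap a h3
    · have := hy (i + 1)
      rw [h3] at this
      omega
  · obtain ⟨a, rfl⟩ : ∃ b, s b = a := ⟨s a, hss a⟩
    obtain ⟨e, rfl⟩ : ∃ b, s b = e := ⟨s e, hss e⟩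
    simp only [hss, lt_swap_succ_iff hs]
    rintro (⟨h3, -⟩ | ⟨rfl, rfl⟩) (⟨h4, -⟩ | ⟨h4', h4⟩)
    · exact h.inside a e h3 h4
    · subst h4'
      right
      have e1 := hy a
      rw [h4] at e1
      apply h.lt_of_unnested hy
      · rw [h4]; omega
      · rw [h4]; omega
    · left
      have e1 := hy (e + 1)
      have e2 := hy e
      apply h.lt_of_unnested hy
      · rw [e1]; omega
      · rw [e1]; omega
    · exfalso; omega
  · obtain ⟨a, rfl⟩ : ∃ b, s b = a := ⟨s a, hss a⟩
    obtain ⟨a', rfl⟩ : ∃ b, s b = a' := ⟨s a', hss a'⟩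
    simp only [hss, lt_swap_succ_iff hs, le_swap_succ_iff hs]
    have hi : ∀ a, (a ≤ y a ∧ ¬ (a = i ∧ y a = i + 1)) ∨ (a = i + 1 ∧ y a = i) → a ≤ y a := by
      rintro a (h3 | ⟨rfl, h3⟩)
      · exact h3.1
      · have := hy (i + 1)
        rw [h3] at this
        omega
    intro h3 h4
    have h3 := hi _ h3
    have h4 := hi _ h4
    have e1 := hy a
    have e2 := hy a'
    rintro (⟨h5, -⟩ | ⟨rfl, rfl⟩) (⟨h6, -⟩ | ⟨h6, h7⟩)
    · exact h.mono a a' h3 h4 h5 h6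
    · rw [h6] at e1; rw [h7] at e2; omega
    · omega
    · omega

theorem IsAtomPattern.unstep (h : IsAtomPattern y w) (hy : ∀ a, y (y a) = a)
    (hs : ∀ a, s a = if a = i then i + 1 else if a = i + 1 then i else a)
    (h1 : y (i + 1) < y i) (h2 : w (i + 1) < w i) (h2' : y i ≠ i + 1) :
    IsAtomPattern (fun a => s (y (s a))) (fun a => w (s a)) := by
  have hss := swap_succ_swap_succ hs
  have h2'' : y (i + 1) ≠ i := fun he => by have := hy (i + 1); rw [he] at this; omega
  refine ⟨fun a => ?_, fun a e => ?_, fun a a' => ?_⟩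
  · obtain ⟨a, rfl⟩ : ∃ b, s b = a := ⟨s a, hss a⟩
    simp only [hss, lt_swap_succ_iff hs]
    rintro (⟨h3, -⟩ | ⟨rfl, h3⟩)
    · exact h.swap a h3
    · exfalso; omega
  · obtain ⟨a, rfl⟩ : ∃ b, s b = a := ⟨s a, hss a⟩
    obtain ⟨e, rfl⟩ : ∃ b, s b = e := ⟨s e, hss e⟩
    simp only [hss, lt_swap_succ_iff hs]
    rintro (⟨h3, -⟩ | ⟨rfl, rfl⟩) (⟨h4, -⟩ | ⟨h4', h4⟩)
    · exact h.inside a e h3 h4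
    · subst h4'; left; rw [h4]; exact h2
    · right; exact h2
    · exfalso; omega
  · obtain ⟨a, rfl⟩ : ∃ b, s b = a := ⟨s a, hss a⟩
    obtain ⟨a', rfl⟩ : ∃ b, s b = a' := ⟨s a', hss a'⟩
    simp only [hss, lt_swap_succ_iff hs, le_swap_succ_iff hs]
    have hi : ∀ a, (a ≤ y a ∧ ¬ (a = i ∧ y a = i + 1)) ∨ (a = i + 1 ∧ y a = i) → a ≤ y a := by
      rintro a (h3 | ⟨rfl, h3⟩)
      · exact h3.1
      · exact absurd h3 h2''
    intro h3 h4
    have h3 := hi _ h3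
    have h4 := hi _ h4
    have e1 := hy a
    have e2 := hy a'
    rintro (⟨h5, -⟩ | ⟨rfl, rfl⟩) (⟨h6, -⟩ | ⟨h6, h7⟩)
    · exact h.mono a a' h3 h4 h5 h6
    · have h8 := h.inside a i (by omega) (by omega)
      rw [h6] at h8
      rw [h7]
      omega
    · have h8 := h.inside a' (a' + 1) (by omega) (by omega)
      omega
    · omega

theorem IsAtomPattern.step_fixed (h : IsAtomPattern y w) (hy : ∀ a, y (y a) = a)
    (hs : ∀ a, s a = if a = i then i + 1 else if a = i + 1 then i else a)
    (h1 : y i = i) (h2 : y (i + 1) = i + 1) :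
    IsAtomPattern (fun a => y (s a)) (fun a => w (s a)) := by
  have hss := swap_succ_swap_succ hs
  have h3 := h.mono i (i + 1) h1.ge h2.ge (by omega) (by omega)
  rw [h2] at h3
  have hsi : s i = i + 1 := by rw [hs]; simp
  have hsi' : s (i + 1) = i := by rw [hs]; simp
  have hys : ∀ a, a = i ∨ a = i + 1 ∨
      (a ≠ i ∧ a ≠ i + 1 ∧ s a = a ∧ y a ≠ i ∧ y a ≠ i + 1 ∧ s (y a) = y a) := by
    intro a
    have := hy a
    have h4 : y a = i → a = i := fun h => by rw [h] at this; omega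
    have h5 : y a = i + 1 → a = i + 1 := fun h => by rw [h] at this; omega
    simp only [hs]
    split_ifs <;> omega
  refine ⟨fun a => ?_, fun a e => ?_, fun a a' => ?_⟩
  · rcases hys a with rfl | rfl | ⟨n1, n2, c, n3, n4, c'⟩
    · simp only [hsi, hsi', h2]; omega
    · simp only [hsi', h1]; omega
    · simp only [c, c']; exact h.swap a
  · rcases hys a with rfl | rfl | ⟨n1, n2, c, n3, n4, c'⟩
    · simp only [hsi, h2]; omega
    · simp only [hsi', h1]; omega
    · simp only [c, c']
      have h4 := h.inside a i
      have h5 := h.inside a (i + 1)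
      rcases hys e with rfl | rfl | ⟨m1, m2, d, m3, m4, d'⟩
      · rw [hsi]; omega
      · rw [hsi']; omega
      · rw [d]; exact h.inside a e
  · rcases hys a with rfl | rfl | ⟨n1, n2, c, n3, n4, c'⟩ <;>
    rcases hys a' with rfl | rfl | ⟨m1, m2, d, m3, m4, d'⟩
    · simp
    · simp only [hsi', h1]; omega
    · have h4 := h.mono (a + 1) a'
      simp only [hsi, d, d', h2] at h4 ⊢; omega
    · simp only [hsi', h1]; omega
    · simp
    · simp only [hsi', h1]; omega
    · have h4 := h.mono a a'
      simp only [hsi, hsi', h1, h2, c] at h4 ⊢; omega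
    · simp only [hsi', h1]; omega
    · simp only [c, d, d']; exact h.mono a a'

theorem IsAtomPattern.unstep_fixed (h : IsAtomPattern y w) (hy : ∀ a, y (y a) = a)
    (hs : ∀ a, s a = if a = i then i + 1 else if a = i + 1 then i else a)
    (h1 : y i = i + 1) (h2 : y (i + 1) = i) :
    IsAtomPattern (fun a => y (s a)) (fun a => w (s a)) := by
  have h3 := h.swap i (by omega)
  rw [h1] at h3
  have hsi : s i = i + 1 := by rw [hs]; simp
  have hsi' : s (i + 1) = i := by rw [hs]; simp
  have hys : ∀ a, a = i ∨ a = i + 1 ∨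
      (a ≠ i ∧ a ≠ i + 1 ∧ s a = a ∧ y a ≠ i ∧ y a ≠ i + 1 ∧ s (y a) = y a) := by
    intro a
    have := hy a
    have h4 : y a = i → a = i + 1 := fun h => by rw [h] at this; omega
    have h5 : y a = i + 1 → a = i := fun h => by rw [h] at this; omega
    simp only [hs]
    split_ifs <;> omega
  refine ⟨fun a => ?_, fun a e => ?_, fun a a' => ?_⟩
  · rcases hys a with rfl | rfl | ⟨n1, n2, c, n3, n4, c'⟩
    · simp only [hsi, h2]; omega
    · simp only [hsi', h1]; omega
    · simp only [c, c']; exact h.swap a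
  · rcases hys a with rfl | rfl | ⟨n1, n2, c, n3, n4, c'⟩
    · simp only [hsi, h2]; omega
    · simp only [hsi', h1]; omega
    · simp only [c, c']
      have h4 := h.inside a i
      have h5 := h.inside a (i + 1)
      rcases hys e with rfl | rfl | ⟨m1, m2, d, m3, m4, d'⟩
      · rw [hsi]; omega
      · rw [hsi']; omega
      · rw [d]; exact h.inside a e
  · rcases hys a with rfl | rfl | ⟨n1, n2, c, n3, n4, c'⟩ <;>
    rcases hys a' with rfl | rfl | ⟨m1, m2, d, m3, m4, d'⟩
    · simp
    · simp only [hsi, hsi', h1, h2]; omega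
    · have h4 := h.mono a a'
      simp only [hsi, d, d', h1, h2] at h4 ⊢; omega
    · simp only [hsi', h1]; omega
    · simp
    · have h4 := h.mono i a'
      simp only [hsi', d, d', h1] at h4 ⊢; omega
    · have h4 := h.mono a a'
      simp only [hsi, h1, h2, c] at h4 ⊢; omega
    · have h4 := h.mono a i
      simp only [hsi', h1, c] at h4 ⊢; omega
    · simp only [c, d, d']; exact h.mono a a'

end

theorem isAtomPattern_one : IsAtomPattern (1 : SZ).1 (1 : SZ).1 := by
  have h1 : ∀ a, (1 : SZ).1 a = a := fun a => rfl
  refine ⟨fun a => ?_, fun a e => ?_, fun a a' => ?_⟩ <;> simp only [h1] <;> omega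

theorem IsInvolution.eq_one_of_isAtomPattern {y : SZ} (hy : IsInvolution y)
    (h : IsAtomPattern y.1 (1 : SZ).1) : y = 1 := by
  have h1 : ∀ a, (1 : SZ).1 a = a := fun a => rfl
  apply Subtype.ext
  ext a
  have h2 := h.swap a
  have h3 := h.swap (y.1 a)
  rw [hy.apply_apply] at h3
  simp only [h1] at h2 h3
  change y.1 a = a
  omega

theorem involutionLen_one : involutionLen 1 = 0 := by
  have : {a : ℤ | a < (1 : SZ).1 a} = ∅ := by
    ext a
    simp
  rw [involutionLen, len_one, this, Set.ncard_empty]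

theorem coe_mul_simple (w : SZ) (i : ℤ) :
    (⇑(w * simple i).1 : ℤ → ℤ) = fun a => w.1 ((simple i).1 a) := rfl

theorem coe_simple_mul_mul_simple (w : SZ) (i : ℤ) :
    (⇑(simple i * (w * simple i)).1 : ℤ → ℤ)
      = fun a => (simple i).1 (w.1 ((simple i).1 a)) := rfl

theorem simple_mul_simple_mul (w : SZ) (i : ℤ) : simple i * (simple i * w) = w := by
  rw [← mul_assoc, simple_mul_simple, one_mul]

/-- Undoing a Demazure conjugation at a descent of an involution. -/
theorem exists_demazureConj_eq {y w : SZ} (hy : IsInvolution y) {i : ℤ}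
    (h : IsAtomPattern y.1 w.1) (hw : w.1 (i + 1) < w.1 i) :
    ∃ y' : SZ, IsInvolution y' ∧ y'.1 i < y'.1 (i + 1) ∧ demazureConj i y' = y ∧
      IsAtomPattern y'.1 (w * simple i).1 := by
  have hyy := hy.apply_apply
  have hd := h.apply_succ_lt hyy hw
  by_cases hi : y.1 i = i + 1
  · have hi' : y.1 (i + 1) = i := by rw [← hi, hyy]
    have e1 : (y * simple i).1 i = i := by rw [mul_simple_apply]; simp [hi']
    have e2 : (y * simple i).1 (i + 1) = i + 1 := by rw [mul_simple_apply]; simp [hi]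
    refine ⟨y * simple i, ?_, by omega, ?_, ?_⟩
    · apply isInvolution_of_apply_apply
      intro a
      have := hyy a
      simp only [mul_simple_apply]
      grind
    · rw [demazureConj_of_fixed e1 e2, mul_simple_mul_simple]
    · rw [coe_mul_simple, coe_mul_simple]
      exact h.unstep_fixed hyy (simple_apply i) hi hi'
  · have hinv : IsInvolution (simple i * (y * simple i)) := by
      apply isInvolution_of_apply_apply
      intro a
      have hs : ∀ x, (simple i).1 ((simple i).1 x) = x := fun x => by simp [simple, tr]
      simp only [mul_apply, hs, hyy]
    have e1 : (simple i * (y * simple i)).1 i = (simple i).1 (y.1 (i + 1)) := by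
      rw [mul_apply, mul_simple_apply]; simp
    have e2 : (simple i * (y * simple i)).1 (i + 1) = (simple i).1 (y.1 i) := by
      rw [mul_apply, mul_simple_apply]; simp
    have f1 := hyy i
    have f2 := hyy (i + 1)
    have hlt : (simple i * (y * simple i)).1 i < (simple i * (y * simple i)).1 (i + 1) := by
      rw [e1, e2, simple_apply, simple_apply]
      grind
    refine ⟨_, hinv, hlt, ?_, ?_⟩
    · rw [demazureConj_of_lt hinv hlt, mul_assoc, mul_simple_mul_simple, simple_mul_simple_mul]
      rw [e1, e2, simple_apply, simple_apply]
      grind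
    · rw [coe_mul_simple, coe_simple_mul_mul_simple]
      exact h.unstep hyy (simple_apply i) hd hw hi

theorem IsAtomPattern.demazureSquare_eq {y w : SZ} (hy : IsInvolution y)
    (h : IsAtomPattern y.1 w.1) : demazureSquare w = y ∧ 2 * len w = involutionLen y := by
  induction hn : len w using Nat.strong_induction_on generalizing w y with
  | _ n ih =>
    by_cases hw : w = 1
    · subst hw
      obtain rfl := hy.eq_one_of_isAtomPattern h
      rw [len_one] at hn
      rw [demazureSquare_one, involutionLen_one, ← hn]
      simp
    · obtain ⟨i, hi⟩ := exists_descent w hw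
      have h2 := len_mul_simple_of_not_lt w i hi
      have h3 := InvAtoms.apply_succ_lt w i hi
      obtain ⟨y', hy', hlt, hyy', hpat⟩ := exists_demazureConj_eq hy h h3
      obtain ⟨h5, h6⟩ := ih _ (by omega) hy' hpat rfl
      have h7 : (w * simple i).1 i < (w * simple i).1 (i + 1) := by
        rw [mul_simple_apply, mul_simple_apply]; simp [h3]
      have h8 := demazureSquare_mul_simple h7
      rw [mul_simple_mul_simple, h5, hyy'] at h8
      have h9 := involutionLen_demazureConj hy' hlt
      rw [hyy'] at h9
      exact ⟨h8, by omega⟩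

theorem isAtomPattern_of_mem_atoms {y w : SZ} (h : w ∈ atoms y) : IsAtomPattern y.1 w.1 := by
  induction hn : len w using Nat.strong_induction_on generalizing w y with
  | _ n ih =>
    obtain ⟨hy, hmin⟩ := h
    change y = demazureSquare w at hy
    change ∀ v, y = demazureSquare v → len w ≤ len v at hmin
    by_cases hw : w = 1
    · subst hw
      rw [demazureSquare_one] at hy
      rw [hy]
      exact isAtomPattern_one
    · obtain ⟨i, hi⟩ := exists_descent w hw
      have h2 := len_mul_simple_of_not_lt w i hi
      have h3 := InvAtoms.apply_succ_lt w i hi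
      obtain ⟨v, hv⟩ : ∃ v, v = w * simple i := ⟨_, rfl⟩
      have hwv : w = v * simple i := by rw [hv, mul_simple_mul_simple]
      have h4 : v.1 i < v.1 (i + 1) := by
        rw [hv, mul_simple_apply, mul_simple_apply]; simp [h3]
      have h5 := demazureSquare_mul_simple h4
      rw [← hwv, ← hy] at h5
      have hinv := isInvolution_demazureSquare v
      rw [← hv] at h2
      have hlt : (demazureSquare v).1 i < (demazureSquare v).1 (i + 1) := by
        by_contra hc
        rw [demazureConj_of_not_lt hinv hc] at h5
        have := hmin v h5
        omega
      have hat : v ∈ atoms (demazureSquare v) := by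
        refine ⟨rfl, fun u hu => ?_⟩
        change demazureSquare v = demazureSquare u at hu
        by_cases hui : u.1 i < u.1 (i + 1)
        · have := hmin (u * simple i) (by rw [demazureSquare_mul_simple hui, ← hu, h5])
          rw [len_mul_simple_of_lt u i hui] at this
          omega
        · exfalso
          have h6 := InvAtoms.apply_succ_lt u i hui
          have h7 : (u * simple i).1 i < (u * simple i).1 (i + 1) := by
            rw [mul_simple_apply, mul_simple_apply]; simp [h6]
          have h8 := demazureSquare_mul_simple h7
          rw [mul_simple_mul_simple, ← hu] at h8
          rw [h8] at hlt
          exact not_lt_demazureConj (isInvolution_demazureSquare _) i hlt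
      have hpat := ih _ (by omega) hat rfl
      rw [h5, hwv]
      by_cases hf : (demazureSquare v).1 i = i ∧ (demazureSquare v).1 (i + 1) = i + 1
      · rw [demazureConj_of_fixed hf.1 hf.2, coe_mul_simple, coe_mul_simple]
        exact hpat.step_fixed hinv.apply_apply (simple_apply i) hf.1 hf.2
      · rw [demazureConj_of_lt hinv hlt hf, coe_mul_simple, coe_simple_mul_mul_simple]
        exact hpat.step hinv.apply_apply (simple_apply i) hlt hf

theorem exists_mem_atoms {y w : SZ} (h : y = demazureSquare w) :
    ∃ v ∈ atoms y, len v ≤ len w := by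
  classical
  have hex : ∃ n, ∃ v, y = demazureSquare v ∧ len v = n := ⟨_, w, h, rfl⟩
  obtain ⟨v, hv, hl⟩ := Nat.find_spec hex
  have hmin : ∀ u, y = demazureSquare u → len v ≤ len u := fun u hu => by
    rw [hl]; exact Nat.find_min' hex ⟨u, hu, rfl⟩
  exact ⟨v, ⟨hv, hmin⟩, hmin w h⟩

/-- The atoms of an involution are the permutations with the atom pattern. -/
theorem mem_atoms_iff {y w : SZ} (hy : IsInvolution y) :
    w ∈ atoms y ↔ IsAtomPattern y.1 w.1 := by
  refine ⟨isAtomPattern_of_mem_atoms, fun h => ?_⟩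
  obtain ⟨h1, h2⟩ := h.demazureSquare_eq hy
  refine ⟨h1.symm, fun u hu => ?_⟩
  obtain ⟨v, hv, hvu⟩ := exists_mem_atoms (y := y) (w := u) hu
  have := ((isAtomPattern_of_mem_atoms hv).demazureSquare_eq hy).2
  omega

/-! ### Transpositions between unnested cycles -/

section

variable {y w : ℤ → ℤ}

theorem IsAtomPattern.le_of_le (h : IsAtomPattern y w) {a : ℤ} (ha : a ≤ y a) :
    w (y a) ≤ w a := by
  rcases ha.lt_or_eq with h1 | h1
  · exact (h.swap a h1).le
  · rw [← h1]

/-- Multiplying by a covering transposition `(i, j)` keeps the condition on the positions inside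
a cycle that contains neither `i` nor `j`. -/
theorem IsAtomPattern.inside_swap {w' : ℤ → ℤ} (h : IsAtomPattern y w) {i j : ℤ} (hij : i < j)
    (hlt : w i < w j) (hcov : ∀ e, i < e → e < j → w e < w i ∨ w j < w e)
    (hw' : ∀ x, (x = i ∧ w' x = w j) ∨ (x = j ∧ w' x = w i) ∨ (x ≠ i ∧ x ≠ j ∧ w' x = w x))
    {x e : ℤ} (hi : x ≠ i) (hj : x ≠ j) (hi' : y x ≠ i) (hj' : y x ≠ j) (h1 : x < e)
    (h2 : e < y x) : w' e < w' (y x) ∨ w' x < w' e := by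
  have k1 := h.inside x i
  have k2 := h.inside x j
  have k3 := h.swap x (by omega)
  have k4 := hcov x
  have k5 := hcov (y x)
  have k6 : w' x = w x := by have := hw' x; omega
  have k7 : w' (y x) = w (y x) := by have := hw' (y x); omega
  rw [k6, k7]
  rcases hw' e with ⟨rfl, k⟩ | ⟨rfl, k⟩ | ⟨_, _, k⟩
  · rw [k]; omega
  · rw [k]; omega
  · rw [k]; exact h.inside x e h1 h2

/-- The values of `w` and of `w' = w (i, j)`, for a covering transposition `(i, j)`, on two
unnested cycles `(a, b)` and `(c, d)` of `y`. -/
structure UnnestedSwap (y w w' : ℤ → ℤ) (a b c d i j : ℤ) : Prop where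
  pattern : IsAtomPattern y w
  invol : ∀ x, y (y x) = x
  a_le : a ≤ b
  c_le : c ≤ d
  a_apply : y a = b
  c_apply : y c = d
  a_lt : a < c
  b_lt : b < d
  lt : i < j
  cover : ∀ e, i < e → e < j → w e < w i ∨ w j < w e
  swap_apply : ∀ x, (x = i ∧ w' x = w j) ∨ (x = j ∧ w' x = w i) ∨ (x ≠ i ∧ x ≠ j ∧ w' x = w x)
  left : i = a ∨ i = b
  right : j = c ∨ j = d

namespace UnnestedSwap

variable {w' : ℤ → ℤ} {a b c d i j : ℤ}

theorem values (h : UnnestedSwap y w w' a b c d i j) :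
    w b ≤ w a ∧ (a < b → w b < w a) ∧ w a < w d ∧ w d ≤ w c ∧ (c < d → w d < w c) := by
  have ha := h.a_le
  have hc := h.c_le
  have h1 := h.pattern.le_of_le (a := a)
  have h2 := h.pattern.le_of_le (a := c)
  have h3 := h.pattern.swap a
  have h4 := h.pattern.swap c
  have h5 := h.pattern.mono a c
  rw [h.a_apply] at h1 h3 h5
  rw [h.c_apply] at h2 h4 h5
  exact ⟨h1 ha, h3, h5 ha hc h.a_lt h.b_lt, h2 hc, h4⟩

theorem b_apply (h : UnnestedSwap y w w' a b c d i j) : y b = a := by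
  rw [← h.a_apply, h.invol]

theorem d_apply (h : UnnestedSwap y w w' a b c d i j) : y d = c := by
  rw [← h.c_apply, h.invol]

theorem b_ne_c (h : UnnestedSwap y w w' a b c d i j) : b ≠ c := by
  rintro rfl
  have := h.b_apply
  have := h.c_apply
  have := h.c_le
  have := h.a_lt
  omega

theorem apply_lt (h : UnnestedSwap y w w' a b c d i j) : w i < w j := by
  obtain ⟨h1, -, h2, h3, -⟩ := h.values
  rcases h.left with h4 | h4 <;> rcases h.right with h5 | h5 <;> rw [h4, h5] <;> omega

theorem swap_cases (h : UnnestedSwap y w w' a b c d i j)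
    (hne : ¬ (i = b ∧ j = c ∧ a < b ∧ c < d)) :
    (i = a ∧ j = d ∧ w' a = w d ∧ w' d = w a ∧ (a < b → w' b = w b) ∧ (c < d → w' c = w c)) ∨
    (i = a ∧ j = c ∧ c < d ∧ w' a = w c ∧ w' d = w d ∧ (a < b → w' b = w b) ∧ w' c = w a) ∨
    (i = b ∧ j = d ∧ a < b ∧ w' a = w a ∧ w' d = w b ∧ w' b = w d ∧ (c < d → w' c = w c)) := by
  obtain ⟨hp, hy, ab, cd, ha, hc, ac, bd, ij, hcov, hs, hl, hr⟩ := h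
  have h1 := hs a
  have h2 := hs b
  have h3 := hs c
  have h4 := hs d
  have h5 : b ≠ c := by
    rintro rfl
    have := hy a
    rw [ha, hc] at this
    omega
  clear hp hy hs hcov ha hc
  rcases ab.eq_or_lt with rfl | ab <;> rcases cd.eq_or_lt with rfl | cd
  · obtain rfl : i = a := by omega
    obtain rfl : j = c := by omega
    refine .inl ⟨rfl, rfl, ?_, ?_, ?_, ?_⟩ <;> omega
  · obtain rfl : i = a := by omega
    rcases hr with rfl | rfl
    · refine .inr (.inl ⟨rfl, rfl, cd, ?_, ?_, ?_, ?_⟩) <;> omega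
    · refine .inl ⟨rfl, rfl, ?_, ?_, ?_, ?_⟩ <;> omega
  · obtain rfl : j = c := by omega
    rcases hl with rfl | rfl
    · refine .inl ⟨rfl, rfl, ?_, ?_, ?_, ?_⟩ <;> omega
    · refine .inr (.inr ⟨rfl, rfl, ab, ?_, ?_, ?_, ?_⟩) <;> omega
  · rcases hl with rfl | rfl <;> rcases hr with rfl | rfl
    · refine .inr (.inl ⟨rfl, rfl, cd, ?_, ?_, ?_, ?_⟩) <;> omega
    · refine .inl ⟨rfl, rfl, ?_, ?_, ?_, ?_⟩ <;> omega
    · exact absurd ⟨rfl, rfl, ab, cd⟩ hne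
    · refine .inr (.inr ⟨rfl, rfl, ab, ?_, ?_, ?_, ?_⟩) <;> omega

theorem outer_swap (h : UnnestedSwap y w w' a b c d i j)
    (hne : ¬ (i = b ∧ j = c ∧ a < b ∧ c < d)) : w' d < w' a := by
  have := h.swap_cases hne
  have := h.values
  omega

theorem outer_inside (h : UnnestedSwap y w w' a b c d i j)
    (hne : ¬ (i = b ∧ j = c ∧ a < b ∧ c < d)) {e : ℤ} (h1 : a < e) (h2 : e < d) (h3 : e ≠ b)
    (h4 : e ≠ c) : w' e < w' d ∨ w' a < w' e := by
  have k1 := h.swap_cases hne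
  have k2 := h.values
  have k3 := h.cover e
  have k4 := h.pattern.inside a e
  have k5 := h.pattern.inside c e
  have k6 : w' e = w e := by
    have := h.swap_apply e
    have := h.left
    have := h.right
    omega
  rw [h.a_apply] at k4
  rw [h.c_apply] at k5
  rw [k6]
  rcases k1 with ⟨rfl, rfl, k⟩ | ⟨rfl, rfl, k⟩ | ⟨rfl, rfl, k⟩ <;> grind

theorem lt_outer (h : UnnestedSwap y w w' a b c d i j)
    (hne : ¬ (i = b ∧ j = c ∧ a < b ∧ c < d)) {x : ℤ} (hx : x ≤ y x) (h1 : x < a)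
    (h2 : y x < d) (h3 : y x ≠ a) (h4 : y x ≠ b) : w x < w' d := by
  have k1 := h.swap_cases hne
  have k2 := h.values
  have k3 := h.cover (y x)
  have k4 := h.pattern.mono x a hx (by rw [h.a_apply]; exact h.a_le) h1
  have k5 := h.pattern.mono x c hx (by rw [h.c_apply]; exact h.c_le) (h1.trans h.a_lt)
  have k6 := h.pattern.inside x i
  have k7 := h.pattern.le_of_le hx
  have := h.a_le
  rw [h.a_apply] at k4
  rw [h.c_apply] at k5
  rcases k1 with ⟨rfl, rfl, k⟩ | ⟨rfl, rfl, k⟩ | ⟨rfl, rfl, k⟩ <;> grind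

theorem outer_lt (h : UnnestedSwap y w w' a b c d i j)
    (hne : ¬ (i = b ∧ j = c ∧ a < b ∧ c < d)) {x : ℤ} (hx : x ≤ y x) (h1 : a < x)
    (h2 : d < y x) (h3 : x ≠ c) (h4 : x ≠ d) : w' a < w (y x) := by
  have k1 := h.swap_cases hne
  have k2 := h.values
  have k3 := h.cover x
  have k4 := h.pattern.mono a x (by rw [h.a_apply]; exact h.a_le) hx h1
  have k5 := h.pattern.mono c x (by rw [h.c_apply]; exact h.c_le) hx
  have k6 := h.pattern.inside x j
  have k7 := h.pattern.le_of_le hx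
  have := h.c_le
  have := h.b_lt
  rw [h.a_apply] at k4
  rw [h.c_apply] at k5
  rcases k1 with ⟨rfl, rfl, k⟩ | ⟨rfl, rfl, k⟩ | ⟨rfl, rfl, k⟩ <;> grind

theorem lt_inner (h : UnnestedSwap y w w' a b c d i j)
    (hne : ¬ (i = b ∧ j = c ∧ a < b ∧ c < d)) (hab : a < b) {x : ℤ} (hx : x ≤ y x) (h1 : x < c)
    (h2 : y x < b) (h3 : x ≠ a) : w x < w' b := by
  have k1 := h.swap_cases hne
  have k2 := h.values
  have k3 := h.cover x
  have k4 := h.pattern.mono x a hx (by rw [h.a_apply]; exact h.a_le)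
  have k5 := h.pattern.mono x c hx (by rw [h.c_apply]; exact h.c_le) h1
  have k6 := h.pattern.inside a x
  have k7 := h.pattern.le_of_le hx
  have := h.c_le
  have := h.b_lt
  rw [h.a_apply] at k4 k6
  rw [h.c_apply] at k5
  rcases k1 with ⟨rfl, rfl, k⟩ | ⟨rfl, rfl, k⟩ | ⟨rfl, rfl, k⟩ <;> grind

theorem inner_lt (h : UnnestedSwap y w w' a b c d i j)
    (hne : ¬ (i = b ∧ j = c ∧ a < b ∧ c < d)) (hcd : c < d) {x : ℤ} (hx : x ≤ y x) (h1 : c < x)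
    (h2 : b < y x) (h3 : y x ≠ d) : w' c < w (y x) := by
  have k1 := h.swap_cases hne
  have k2 := h.values
  have k3 := h.cover (y x)
  have k4 := h.pattern.mono a x (by rw [h.a_apply]; exact h.a_le) hx (h.a_lt.trans h1)
  have k5 := h.pattern.mono c x (by rw [h.c_apply]; exact h.c_le) hx
  have k6 := h.pattern.inside c (y x)
  have k7 := h.pattern.le_of_le hx
  have := h.a_le
  have := h.a_lt
  rw [h.a_apply] at k4
  rw [h.c_apply] at k5 k6
  rcases k1 with ⟨rfl, rfl, k⟩ | ⟨rfl, rfl, k⟩ | ⟨rfl, rfl, k⟩ <;> grind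

/-- The right end of the left cycle precedes, in value, every cycle to the right of it. -/
theorem left_lt (h : UnnestedSwap y w w' a b c d i j)
    (hne : ¬ (i = b ∧ j = c ∧ a < b ∧ c < d)) (hbc : b < c) (hab : a < b) {x : ℤ} (hx : x ≤ y x)
    (h1 : b < x) (h3 : x ≠ c) (h4 : y x ≠ d) (h5 : x ≠ d) (h6 : y x ≠ c) : w' b < w (y x) := by
  have k1 := h.swap_cases hne
  have k2 := h.values
  have k3 := h.cover x
  have k3' := h.cover (y x)
  have k4 := h.pattern.mono a x (by rw [h.a_apply]; exact h.a_le) hx (by omega)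
  have k5 := h.pattern.mono c x (by rw [h.c_apply]; exact h.c_le) hx
  have k5' := h.pattern.mono x c hx (by rw [h.c_apply]; exact h.c_le)
  have k6 := h.pattern.inside c (y x)
  have k6' := h.pattern.inside x d
  have k7 := h.pattern.le_of_le hx
  have := h.c_le
  rw [h.a_apply] at k4
  rw [h.c_apply] at k5 k5' k6
  rcases k1 with ⟨rfl, rfl, k⟩ | ⟨rfl, rfl, k⟩ | ⟨rfl, rfl, k⟩ <;> grind

theorem lt_right (h : UnnestedSwap y w w' a b c d i j)
    (hne : ¬ (i = b ∧ j = c ∧ a < b ∧ c < d)) (hbc : b < c) (hcd : c < d) {x : ℤ} (hx : x ≤ y x)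
    (h1 : y x < c) (h3 : y x ≠ b) (h4 : x ≠ a) (h5 : y x ≠ a) (h6 : x ≠ b) : w x < w' c := by
  have k1 := h.swap_cases hne
  have k2 := h.values
  have k3 := h.cover x
  have k3' := h.cover (y x)
  have k4 := h.pattern.mono x c hx (by rw [h.c_apply]; exact h.c_le) (by omega)
  have k5 := h.pattern.mono x a hx (by rw [h.a_apply]; exact h.a_le)
  have k5' := h.pattern.mono a x (by rw [h.a_apply]; exact h.a_le) hx
  have k6 := h.pattern.inside a x
  have k6' := h.pattern.inside x a
  have k7 := h.pattern.le_of_le hx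
  have := h.a_le
  rw [h.a_apply] at k5 k5' k6
  rw [h.c_apply] at k4
  rcases k1 with ⟨rfl, rfl, k⟩ | ⟨rfl, rfl, k⟩ | ⟨rfl, rfl, k⟩ <;> grind

end UnnestedSwap
end

section

variable {y w w' z : ℤ → ℤ} {a b c d i j : ℤ}

namespace UnnestedSwap

theorem swap_apply_of_ne (h : UnnestedSwap y w w' a b c d i j) {x : ℤ} (h1 : x ≠ a) (h2 : x ≠ b)
    (h3 : x ≠ c) (h4 : x ≠ d) : w' x = w x := by
  have := h.swap_apply x
  have := h.left
  have := h.right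
  omega

theorem apply_ne (h : UnnestedSwap y w w' a b c d i j) {x : ℤ} (h1 : x ≠ a) (h2 : x ≠ b)
    (h3 : x ≠ c) (h4 : x ≠ d) : y x ≠ a ∧ y x ≠ b ∧ y x ≠ c ∧ y x ≠ d := by
  have := h.invol x
  have := h.a_apply
  have := h.b_apply
  have := h.c_apply
  have := h.d_apply
  refine ⟨?_, ?_, ?_, ?_⟩ <;> grind

theorem inside_of_ne (h : UnnestedSwap y w w' a b c d i j) {x e : ℤ} (h1 : x ≠ a) (h2 : x ≠ b)
    (h3 : x ≠ c) (h4 : x ≠ d) (h5 : x < e) (h6 : e < y x) : w' e < w' (y x) ∨ w' x < w' e := by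
  obtain ⟨g1, g2, g3, g4⟩ := h.apply_ne h1 h2 h3 h4
  apply h.pattern.inside_swap h.lt h.apply_lt h.cover h.swap_apply _ _ _ _ h5 h6
  all_goals
    have := h.left
    have := h.right
    omega

theorem facts_of_ne (h : UnnestedSwap y w w' a b c d i j) {x t : ℤ}
    (hx : x ≠ a ∧ x ≠ b ∧ x ≠ c ∧ x ≠ d ∧ t = y x) :
    (x ≠ a ∧ x ≠ b ∧ x ≠ c ∧ x ≠ d) ∧ (y x ≠ a ∧ y x ≠ b ∧ y x ≠ c ∧ y x ≠ d) ∧ t = y x ∧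
      w' x = w x ∧ w' (y x) = w (y x) := by
  obtain ⟨n1, n2, n3, n4, g⟩ := hx
  have hn := h.apply_ne n1 n2 n3 n4
  exact ⟨⟨n1, n2, n3, n4⟩, hn, g, h.swap_apply_of_ne n1 n2 n3 n4,
    h.swap_apply_of_ne hn.1 hn.2.1 hn.2.2.1 hn.2.2.2⟩

theorem isAtomPattern_disjoint (h : UnnestedSwap y w w' a b c d i j)
    (hne : ¬ (i = b ∧ j = c ∧ a < b ∧ c < d)) (hbc : b < c)
    (hz : ∀ x, (x = a ∧ z x = d) ∨ (x = d ∧ z x = a) ∨ (x = b ∧ a < b ∧ z x = b) ∨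
      (x = c ∧ c < d ∧ z x = c) ∨ (x ≠ a ∧ x ≠ b ∧ x ≠ c ∧ x ≠ d ∧ z x = y x)) :
    IsAtomPattern z w' := by
  have ab := h.a_le
  have cd := h.c_le
  refine ⟨fun x => ?_, fun x e => ?_, fun x x' => ?_⟩
  · rcases hz x with ⟨rfl, g⟩ | ⟨rfl, g⟩ | ⟨rfl, _, g⟩ | ⟨rfl, _, g⟩ | ⟨n1, n2, n3, n4, g⟩
    · rw [g]; exact fun _ => h.outer_swap hne
    · omega
    · omega
    · omega
    · obtain ⟨g1, g2, g3, g4⟩ := h.apply_ne n1 n2 n3 n4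
      rw [g, h.swap_apply_of_ne n1 n2 n3 n4, h.swap_apply_of_ne g1 g2 g3 g4]
      exact h.pattern.swap x
  · rcases hz x with ⟨rfl, g⟩ | ⟨rfl, g⟩ | ⟨rfl, _, g⟩ | ⟨rfl, _, g⟩ | ⟨n1, n2, n3, n4, g⟩
    · rw [g]
      intro k1 k2
      have k3 := h.values
      have k4 := h.swap_cases hne
      by_cases k5 : e = b
      · subst k5; omega
      · by_cases k6 : e = c
        · subst k6; omega
        · exact h.outer_inside hne k1 k2 k5 k6
    · omega
    · omega
    · omega
    · rw [g]; exact h.inside_of_ne n1 n2 n3 n4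
  · have k3 := h.values
    have k4 := h.swap_cases hne
    rcases (hz x).imp_right (Or.imp_right (Or.imp_right (Or.imp_right h.facts_of_ne))) with
      ⟨rfl, g⟩ | ⟨rfl, g⟩ | ⟨rfl, _, g⟩ | ⟨rfl, _, g⟩ |
        ⟨⟨n1, n2, n3, n4⟩, ⟨g1, g2, g3, g4⟩, g, hx, hyx⟩ <;>
    rcases (hz x').imp_right (Or.imp_right (Or.imp_right (Or.imp_right h.facts_of_ne))) with
      ⟨rfl, g'⟩ | ⟨rfl, g'⟩ | ⟨rfl, _, g'⟩ | ⟨rfl, _, g'⟩ |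
        ⟨⟨m1, m2, m3, m4⟩, ⟨g1', g2', g3', g4'⟩, g', hx', hyx'⟩
    all_goals try omega
    all_goals rw [g, g']
    all_goals intro l1 l2 l3 l4
    all_goals try rw [hx]
    all_goals try rw [hyx']
    all_goals try omega
    · exact h.outer_lt hne l2 l3 l4 m3 m4
    · exact h.left_lt hne hbc ‹_› l2 l3 m3 g4' m4 g3'
    · exact h.inner_lt hne ‹_› l2 l3 (by omega) g4'
    · exact h.lt_outer hne l1 l3 l4 g1 g2
    · exact h.lt_inner hne ‹_› l1 (by omega) l4 n1
    · exact h.lt_right hne hbc ‹_› l1 l4 g2 n1 g1 n2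
    · exact h.pattern.mono x x' l1 l2 l3 l4

theorem isAtomPattern_overlap (h : UnnestedSwap y w w' a b c d i j) (hcb : c < b)
    (hz : ∀ x, (x = a ∧ z x = d) ∨ (x = d ∧ z x = a) ∨ (x = b ∧ z x = c) ∨
      (x = c ∧ z x = b) ∨ (x ≠ a ∧ x ≠ b ∧ x ≠ c ∧ x ≠ d ∧ z x = y x)) :
    IsAtomPattern z w' := by
  have hij := h.lt
  have hne : ¬ (i = b ∧ j = c ∧ a < b ∧ c < d) := by omega
  have ac := h.a_lt
  have bd := h.b_lt
  have k3 := h.values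
  have k4 := h.swap_cases hne
  refine ⟨fun x => ?_, fun x e => ?_, fun x x' => ?_⟩
  · rcases hz x with ⟨rfl, g⟩ | ⟨rfl, g⟩ | ⟨rfl, g⟩ | ⟨rfl, g⟩ | ⟨n1, n2, n3, n4, g⟩
    · rw [g]; exact fun _ => h.outer_swap hne
    · omega
    · omega
    · rw [g]; omega
    · obtain ⟨g1, g2, g3, g4⟩ := h.apply_ne n1 n2 n3 n4
      rw [g, h.swap_apply_of_ne n1 n2 n3 n4, h.swap_apply_of_ne g1 g2 g3 g4]
      exact h.pattern.swap x
  · rcases hz x with ⟨rfl, g⟩ | ⟨rfl, g⟩ | ⟨rfl, g⟩ | ⟨rfl, g⟩ | ⟨n1, n2, n3, n4, g⟩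
    · rw [g]
      intro k1 k2
      by_cases k5 : e = b
      · subst k5; omega
      · by_cases k6 : e = c
        · subst k6; omega
        · exact h.outer_inside hne k1 k2 k5 k6
    · omega
    · omega
    · rw [g]
      intro k1 k2
      have l1 := h.pattern.inside a e (by omega) (by rw [h.a_apply]; omega)
      have l2 := h.pattern.inside x e (by omega) (by rw [h.c_apply]; omega)
      have l3 := h.cover e
      rw [h.a_apply] at l1
      rw [h.c_apply] at l2
      rw [h.swap_apply_of_ne (x := e) (by omega) (by omega) (by omega) (by omega)]
      rcases k4 with ⟨rfl, rfl, k⟩ | ⟨rfl, rfl, k⟩ | ⟨rfl, rfl, k⟩ <;> grind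
    · rw [g]; exact h.inside_of_ne n1 n2 n3 n4
  · rcases (hz x).imp_right (Or.imp_right (Or.imp_right (Or.imp_right h.facts_of_ne))) with
      ⟨rfl, g⟩ | ⟨rfl, g⟩ | ⟨rfl, g⟩ | ⟨rfl, g⟩ |
        ⟨⟨n1, n2, n3, n4⟩, ⟨g1, g2, g3, g4⟩, g, hx, hyx⟩ <;>
    rcases (hz x').imp_right (Or.imp_right (Or.imp_right (Or.imp_right h.facts_of_ne))) with
      ⟨rfl, g'⟩ | ⟨rfl, g'⟩ | ⟨rfl, g'⟩ | ⟨rfl, g'⟩ |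
        ⟨⟨m1, m2, m3, m4⟩, ⟨g1', g2', g3', g4'⟩, g', hx', hyx'⟩
    all_goals try omega
    all_goals rw [g, g']
    all_goals intro l1 l2 l3 l4
    all_goals try rw [hx]
    all_goals try rw [hyx']
    · exact h.outer_lt hne l2 l3 l4 m3 m4
    · exact h.inner_lt hne (by omega) l2 l3 l4 g4'
    · exact h.lt_outer hne l1 l3 l4 g1 g2
    · exact h.lt_inner hne (by omega) l1 l3 l4 n1
    · exact h.pattern.mono x x' l1 l2 l3 l4

theorem isAtomPattern_cross (h : UnnestedSwap y w w' a b c d i j)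
    (hi : i = b) (hj : j = c) (hab : a < b) (hcd : c < d)
    (hz : ∀ x, (x = a ∧ z x = c) ∨ (x = c ∧ z x = a) ∨ (x = b ∧ z x = d) ∨
      (x = d ∧ z x = b) ∨ (x ≠ a ∧ x ≠ b ∧ x ≠ c ∧ x ≠ d ∧ z x = y x)) :
    IsAtomPattern z w' := by
  have hbc := h.lt
  rw [hi, hj] at hbc
  have k3 := h.values
  have hcov : ∀ e, b < e → e < c → w e < w b ∨ w c < w e := by
    have := h.cover
    rwa [hi, hj] at this
  have ha : w' a = w a := by have := h.swap_apply a; omega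
  have hb : w' b = w c := by have := h.swap_apply b; rw [hi, hj] at this; omega
  have hc : w' c = w b := by have := h.swap_apply c; rw [hi, hj] at this; omega
  have hd : w' d = w d := by have := h.swap_apply d; omega
  refine ⟨fun x => ?_, fun x e => ?_, fun x x' => ?_⟩
  · rcases hz x with ⟨rfl, g⟩ | ⟨rfl, g⟩ | ⟨rfl, g⟩ | ⟨rfl, g⟩ | ⟨n1, n2, n3, n4, g⟩
    · rw [g]; omega
    · omega
    · rw [g]; omega
    · omega
    · obtain ⟨g1, g2, g3, g4⟩ := h.apply_ne n1 n2 n3 n4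
      rw [g, h.swap_apply_of_ne n1 n2 n3 n4, h.swap_apply_of_ne g1 g2 g3 g4]
      exact h.pattern.swap x
  · rcases hz x with ⟨rfl, g⟩ | ⟨rfl, g⟩ | ⟨rfl, g⟩ | ⟨rfl, g⟩ | ⟨n1, n2, n3, n4, g⟩
    · rw [g]
      intro k1 k2
      by_cases k5 : e = b
      · subst k5; omega
      have l1 := h.pattern.inside x e k1
      have l2 := hcov e
      rw [h.a_apply] at l1
      rw [h.swap_apply_of_ne (x := e) (by omega) (by omega) (by omega) (by omega)]
      omega
    · omega
    · rw [g]
      intro k1 k2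
      by_cases k5 : e = c
      · subst k5; omega
      have l1 := h.pattern.inside c e
      have l2 := hcov e
      rw [h.c_apply] at l1
      rw [h.swap_apply_of_ne (x := e) (by omega) (by omega) (by omega) (by omega)]
      omega
    · omega
    · rw [g]; exact h.inside_of_ne n1 n2 n3 n4
  · rcases (hz x).imp_right (Or.imp_right (Or.imp_right (Or.imp_right h.facts_of_ne))) with
      ⟨rfl, g⟩ | ⟨rfl, g⟩ | ⟨rfl, g⟩ | ⟨rfl, g⟩ |
        ⟨⟨n1, n2, n3, n4⟩, ⟨g1, g2, g3, g4⟩, g, hx, hyx⟩ <;>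
    rcases (hz x').imp_right (Or.imp_right (Or.imp_right (Or.imp_right h.facts_of_ne))) with
      ⟨rfl, g'⟩ | ⟨rfl, g'⟩ | ⟨rfl, g'⟩ | ⟨rfl, g'⟩ |
        ⟨⟨m1, m2, m3, m4⟩, ⟨g1', g2', g3', g4'⟩, g', hx', hyx'⟩
    all_goals try omega
    all_goals rw [g, g']
    all_goals intro l1 l2 l3 l4
    all_goals try rw [hx]
    all_goals try rw [hyx']
    all_goals try omega
    · have := h.pattern.mono x x' (by rw [h.a_apply]; omega) l2 l3
      rw [h.a_apply] at this
      omega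
    · have r1 := h.pattern.mono a x' (by rw [h.a_apply]; omega) l2 (by omega)
      have r2 := h.pattern.mono c x' (by rw [h.c_apply]; omega) l2
      have r3 := h.pattern.inside x' c
      have r4 := hcov x'
      have r5 := h.pattern.le_of_le l2
      rw [h.a_apply] at r1
      rw [h.c_apply] at r2
      omega
    · have r1 := h.pattern.mono x x' l1 (by rw [h.a_apply]; omega) (by omega)
      have r2 := h.pattern.mono x c l1 (by rw [h.c_apply]; omega) (by omega)
      have r3 := h.pattern.inside x b
      have r4 := hcov (y x)
      have r5 := h.pattern.le_of_le l1
      rw [h.a_apply] at r1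
      rw [h.c_apply] at r2
      omega
    · have r2 := h.pattern.mono x c l1 (by rw [h.c_apply]; omega)
      rw [h.c_apply] at r2
      omega
    · exact h.pattern.mono x x' l1 l2 l3 l4

end UnnestedSwap

end

/-- A covering transposition between unnested cycles of an involution leads to an atom. -/
theorem UnnestedSwap.exists_mem_atoms {y w : SZ} {a b c d i j : ℤ}
    (h : UnnestedSwap y.1 w.1 (w * tr i j).1 a b c d i j) :
    ∃ z : SZ, IsInvolution z ∧ w * tr i j ∈ atoms z := by
  have ab := h.a_le
  have cd := h.c_le
  have ac := h.a_lt
  have bd := h.b_lt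
  have ha := h.a_apply
  have hb := h.b_apply
  have hc := h.c_apply
  have hd := h.d_apply
  have hbc := h.b_ne_c
  have hyy := h.invol
  have hn := fun x => h.apply_ne (x := x)
  by_cases hE : i = b ∧ j = c ∧ a < b ∧ c < d
  · obtain ⟨z, hz⟩ : ∃ z, z = y * tr a b * tr c d * tr a c * tr b d := ⟨_, rfl⟩
    have hz' : ∀ x, (x = a ∧ z.1 x = c) ∨ (x = c ∧ z.1 x = a) ∨ (x = b ∧ z.1 x = d) ∨
      (x = d ∧ z.1 x = b) ∨ (x ≠ a ∧ x ≠ b ∧ x ≠ c ∧ x ≠ d ∧ z.1 x = y.1 x) := by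
      intro x
      rw [hz]
      simp only [mul_apply, tr_apply]
      grind
    have hinv : IsInvolution z := by
      apply isInvolution_of_apply_apply
      intro x
      have := hz' x
      have := hz' (z.1 x)
      have := hn x
      have := hyy x
      grind
    exact ⟨z, hinv, (mem_atoms_iff hinv).2
      (h.isAtomPattern_cross hE.1 hE.2.1 hE.2.2.1 hE.2.2.2 hz')⟩
  rcases lt_or_gt_of_ne hbc with hlt | hlt
  · obtain ⟨z, hz⟩ : ∃ z, z = y * tr a b * tr c d * tr a d := ⟨_, rfl⟩
    have hz' : ∀ x, (x = a ∧ z.1 x = d) ∨ (x = d ∧ z.1 x = a) ∨ (x = b ∧ a < b ∧ z.1 x = b) ∨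
      (x = c ∧ c < d ∧ z.1 x = c) ∨ (x ≠ a ∧ x ≠ b ∧ x ≠ c ∧ x ≠ d ∧ z.1 x = y.1 x) := by
      intro x
      rw [hz]
      simp only [mul_apply, tr_apply]
      grind
    have hinv : IsInvolution z := by
      apply isInvolution_of_apply_apply
      intro x
      have := hz' x
      have := hz' (z.1 x)
      have := hn x
      have := hyy x
      grind
    exact ⟨z, hinv, (mem_atoms_iff hinv).2 (h.isAtomPattern_disjoint hE hlt hz')⟩
  · obtain ⟨z, hz⟩ : ∃ z, z = y * tr a b * tr c d * tr a d * tr b c := ⟨_, rfl⟩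
    have hz' : ∀ x, (x = a ∧ z.1 x = d) ∨ (x = d ∧ z.1 x = a) ∨ (x = b ∧ z.1 x = c) ∨
      (x = c ∧ z.1 x = b) ∨ (x ≠ a ∧ x ≠ b ∧ x ≠ c ∧ x ≠ d ∧ z.1 x = y.1 x) := by
      intro x
      rw [hz]
      simp only [mul_apply, tr_apply]
      grind
    have hinv : IsInvolution z := by
      apply isInvolution_of_apply_apply
      intro x
      have := hz' x
      have := hz' (z.1 x)
      have := hn x
      have := hyy x
      grind
    exact ⟨z, hinv, (mem_atoms_iff hinv).2 (h.isAtomPattern_overlap hlt hz')⟩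

/-! ### Transpositions between nested cycles -/

/-- The pattern condition between a cycle `(a, b)` with values `wa`, `wb` and a
cycle `(p, q)` with values `wp`, `wq`. -/
def CyclesCompatible (a b wa wb p q wp wq : ℤ) : Prop :=
  (p < a → q < b → wp < wb) ∧ (a < p → b < q → wa < wq) ∧
  (a < p → p < b → wp < wb ∨ wa < wp) ∧ (a < q → q < b → wq < wb ∨ wa < wq) ∧
  (p < a → a < q → wa < wq ∨ wp < wa) ∧ (p < b → b < q → wb < wq ∨ wp < wb)

/-- The values of `w` and of an atom obtained from `w (i, d)`, where `(a, b)` is nested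
in `(c, d)`. -/
def NestedValues (a b i wa wb wc wd va vb vc vd : ℤ) : Prop :=
  (a = b ∧ i = a ∧ wa < wd ∧ wb = wa ∧ vc = wd ∧ va = wc ∧ vb = wc ∧ vd = wa) ∨
  (a < b ∧ i = a ∧ wb < wa ∧ wa < wd ∧ vc = wd ∧ va = wc ∧ vb = wb ∧ vd = wa) ∨
  (a < b ∧ i = b ∧ wb < wd ∧ wc < wa ∧ vc = wd ∧ va = wa ∧ vb = wc ∧ vd = wb) ∨
  (a < b ∧ i = b ∧ wb < wa ∧ wa < wd ∧ vc = wa ∧ va = wc ∧ vb = wd ∧ vd = wb)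

theorem NestedValues.cyclesCompatible {a b c d i wa wb wc wd va vb vc vd wi p q wp wq : ℤ}
    (h : NestedValues a b i wa wb wc wd va vb vc vd) (h1 : c < a) (h2 : b < d)
    (h3 : wd < wc) (hia : i = a → wi = wa) (hib : i = b → wi = wb)
    (hpa : p ≠ a) (hpc : p ≠ c) (hqa : q ≠ a) (hqb : q ≠ b) (hqd : q ≠ d) (hpq : p ≤ q) (hw : wq ≤ wp)
    (hab : CyclesCompatible a b wa wb p q wp wq) (hcd : CyclesCompatible c d wc wd p q wp wq)
    (cp : i < p → p < d → wp < wi ∨ wd < wp) (cq : i < q → q < d → wq < wi ∨ wd < wq) :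
    CyclesCompatible a b va vb p q wp wq ∧ CyclesCompatible c d vc vd p q wp wq := by
  unfold CyclesCompatible at *
  rcases h with h | h | h | h
  · refine ⟨⟨?_, ?_, ?_, ?_, ?_, ?_⟩, ⟨?_, ?_, ?_, ?_, ?_, ?_⟩⟩ <;> grind
  · refine ⟨⟨?_, ?_, ?_, ?_, ?_, ?_⟩, ⟨?_, ?_, ?_, ?_, ?_, ?_⟩⟩ <;> grind
  · refine ⟨⟨?_, ?_, ?_, ?_, ?_, ?_⟩, ⟨?_, ?_, ?_, ?_, ?_, ?_⟩⟩ <;> grind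
  · refine ⟨⟨?_, ?_, ?_, ?_, ?_, ?_⟩, ⟨?_, ?_, ?_, ?_, ?_, ?_⟩⟩ <;> grind

/-- No permutation with the atom pattern arises from `w (i, d)` by a transposition that involves
a cycle `(p, q)` other than the nested cycles `(a, b)` and `(c, d)`. -/
theorem not_cyclesCompatible_swap
    {a b c d p q i r wa wb wc wd wp wq wi wr va vb vc vd vp vq vi vr : ℤ}
    (h1 : c < a) (h2 : b < d) (hab : a ≤ b) (hpq : p ≤ q)
    (hpa : p ≠ a) (hpb : p ≠ b) (hpc : p ≠ c) (hqa : q ≠ a)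
    (hqb : q ≠ b) (hqc : q ≠ c) (hqd : q ≠ d)
    (hi : (i = a ∧ wi = wa ∧ vi = va ∧ (a < b → vb = wb)) ∨
      (i = b ∧ wi = wb ∧ vi = vb ∧ (a < b → va = wa)))
    (hr : (r = p ∧ wr = wp ∧ vr = vp ∧ (p < q → vq = wq)) ∨
      (r = q ∧ wr = wq ∧ vr = vq ∧ (p < q → vp = wp)))
    (hv : (vi = wr ∧ vr = wd ∧ vd = wi ∧ vc = wc) ∨ (vd = wr ∧ vr = wi ∧ vi = wd ∧ vc = wc) ∨
      (vc = wr ∧ vr = wc ∧ vi = wd ∧ vd = wi))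
    (hid : wi < wd) (wab : a < b → wb < wa) (wab' : a = b → wa = wb) (vab : a < b → vb < va)
    (vab' : a = b → va = vb) (wpq : p < q → wq < wp) (wpq' : p = q → wp = wq)
    (vpq : p < q → vq < vp) (vpq' : p = q → vp = vq) (wcd : wd < wc) (vcd : vd < vc)
    (w1 : CyclesCompatible a b wa wb c d wc wd) (w2 : CyclesCompatible a b wa wb p q wp wq)
    (w3 : CyclesCompatible c d wc wd p q wp wq) (v1 : CyclesCompatible a b va vb c d vc vd)
    (v2 : CyclesCompatible a b va vb p q vp vq) (v3 : CyclesCompatible c d vc vd p q vp vq)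
    (cp : i < p → p < d → wp < wi ∨ wd < wp) (cq : i < q → q < d → wq < wi ∨ wd < wq) :
    False := by
  unfold CyclesCompatible at *
  rcases hab.eq_or_lt with hab | hab <;> rcases hpq.eq_or_lt with hpq | hpq <;>
  rcases hi with hi | hi <;> rcases hr with hr | hr <;> rcases hv with hv | hv | hv <;> grind

theorem CyclesCompatible.symm {a b wa wb p q wp wq : ℤ}
    (h : CyclesCompatible a b wa wb p q wp wq) : CyclesCompatible p q wp wq a b wa wb := by
  obtain ⟨h1, h2, h3, h4, h5, h6⟩ := h
  exact ⟨h2, h1, h5, h6, h3, h4⟩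

theorem CyclesCompatible.refl {a b wa wb : ℤ} : CyclesCompatible a b wa wb a b wa wb := by
  refine ⟨?_, ?_, ?_, ?_, ?_, ?_⟩ <;> omega

section

variable {y w : ℤ → ℤ}

/-- Every integer lies on a cycle. -/
theorem exists_cycle (hy : ∀ a, y (y a) = a) (e : ℤ) :
    ∃ p q, p ≤ q ∧ y p = q ∧ y q = p ∧ ((e = p ∧ y e = q) ∨ (e = q ∧ y e = p)) := by
  have := hy e
  rcases le_total e (y e) with h | h
  · exact ⟨e, y e, h, rfl, this, .inl ⟨rfl, rfl⟩⟩
  · exact ⟨y e, e, h, this, rfl, .inr ⟨rfl, rfl⟩⟩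

theorem IsAtomPattern.cyclesCompatible (h : IsAtomPattern y w) {a b p q : ℤ} (hab : a ≤ b)
    (hb : y a = b) (hpq : p ≤ q) (hq : y p = q) :
    CyclesCompatible a b (w a) (w b) p q (w p) (w q) := by
  subst hb hq
  exact ⟨h.mono p a hpq hab, h.mono a p hab hpq, h.inside a p, h.inside a (y p), h.inside p a,
    h.inside p (y a)⟩

theorem isAtomPattern_of_cyclesCompatible (hy : ∀ a, y (y a) = a)
    (hswap : ∀ a, a < y a → w (y a) < w a)
    (hc : ∀ a p, a ≤ y a → p ≤ y p →
      CyclesCompatible a (y a) (w a) (w (y a)) p (y p) (w p) (w (y p))) :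
    IsAtomPattern y w := by
  refine ⟨hswap, fun a e h1 h2 => ?_, fun a p h1 h2 => (hc a p h1 h2).symm.1⟩
  have ha : a ≤ y a := by omega
  rcases le_total e (y e) with h3 | h3
  · exact (hc a e ha h3).2.2.1 h1 h2
  · have := (hc a (y e) ha (by rw [hy]; exact h3)).2.2.2.1
    rw [hy] at this
    exact this h1 h2

/-- The reflection of the integers acts on pairs with the atom pattern. -/
theorem IsAtomPattern.neg (h : IsAtomPattern y w) (hy : ∀ a, y (y a) = a) :
    IsAtomPattern (fun a => -y (-a)) (fun a => -w (-a)) := by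
  refine ⟨fun a => ?_, fun a e => ?_, fun a a' => ?_⟩
  · have := h.swap (y (-a))
    rw [hy] at this
    simp only [neg_neg]
    omega
  · have := h.inside (y (-a)) (-e)
    rw [hy] at this
    simp only [neg_neg]
    omega
  · have := h.mono (y (-a')) (y (-a))
    rw [hy, hy] at this
    simp only [neg_neg]
    omega

end

/-- A cycle `(a, b)` nested in a cycle `(c, d)` of `y`, and a covering transposition `(i, d)` of
an atom `w` of `y` with `i` in the inner cycle. -/
structure NestedSwap (y w : ℤ → ℤ) (a b c d i : ℤ) : Prop where
  pattern : IsAtomPattern y w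
  invol : ∀ x, y (y x) = x
  a_le : a ≤ b
  c_lt : c < a
  lt_d : b < d
  a_apply : y a = b
  c_apply : y c = d
  mem : i = a ∨ i = b
  lt : w i < w d
  cover : ∀ e, i < e → e < d → w e < w i ∨ w d < w e

namespace NestedSwap

variable {y w : ℤ → ℤ} {a b c d i : ℤ}

theorem cycle_of_ne (h : NestedSwap y w a b c d i) {x : ℤ} (hx : x ≤ y x) (h1 : x ≠ a)
    (h2 : x ≠ c) : (x ≠ b ∧ x ≠ d) ∧ (y x ≠ a ∧ y x ≠ b ∧ y x ≠ c ∧ y x ≠ d) := by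
  have := h.invol x
  have := h.invol a
  have := h.invol c
  have := h.a_apply
  have := h.c_apply
  have := h.a_le
  have := h.c_lt
  have := h.lt_d
  refine ⟨⟨?_, ?_⟩, ?_, ?_, ?_, ?_⟩ <;> grind

theorem values (h : NestedSwap y w a b c d i) :
    w d < w c ∧ (a < b → w b < w a) ∧ (w a < w d ∨ w c < w a) := by
  have h1 := h.a_le
  have h2 := h.c_lt
  have h3 := h.lt_d
  have h4 := h.pattern.swap a
  have h5 := h.pattern.swap c
  have h6 := h.pattern.inside c a
  rw [h.a_apply] at h4
  rw [h.c_apply] at h5 h6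
  exact ⟨h5 (by omega), h4, h6 h2 (by omega)⟩

theorem isAtomPattern (h : NestedSwap y w a b c d i) {t : ℤ}
    (ht : (t = a ∧ w a < w d) ∨ (t = b ∧ w c < w a)) :
    IsAtomPattern y (fun x => w (Equiv.swap i d (Equiv.swap c t x))) := by
  obtain ⟨v, hv⟩ : ∃ v, v = fun x => w (Equiv.swap i d (Equiv.swap c t x)) := ⟨_, rfl⟩
  rw [← hv]
  have ab := h.a_le
  have ca := h.c_lt
  have bd := h.lt_d
  have ha := h.a_apply
  have hc := h.c_apply
  have hid := h.lt
  obtain ⟨w1, w2, w3⟩ := h.values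
  have hvo : ∀ x, x ≠ a → x ≠ b → x ≠ c → x ≠ d → v x = w x := by
    intro x n1 n2 n3 n4
    have := h.mem
    rw [hv]
    simp only [Equiv.swap_apply_def]
    grind
  have hN : NestedValues a b i (w a) (w b) (w c) (w d) (v a) (v b) (v c) (v d) := by
    have hm := h.mem
    have hva := congrFun hv a
    have hvb := congrFun hv b
    have hvc := congrFun hv c
    have hvd := congrFun hv d
    simp only [Equiv.swap_apply_def] at hva hvb hvc hvd
    clear hvo hv
    unfold NestedValues
    have cd : c < d := by omega
    have cb : c < b := by omega
    have ad : a < d := by omega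
    rcases ab.eq_or_lt with rfl | ab
    · obtain rfl : i = a := by omega
      obtain rfl : t = i := by omega
      simp [ca.ne, ca.ne', cd.ne, cd.ne', ad.ne'] at hva hvc hvd
      omega
    · rcases hm with rfl | rfl <;> rcases ht with ⟨rfl, ht⟩ | ⟨rfl, ht⟩ <;>
      simp [ca.ne, ca.ne', cd.ne, cd.ne', ad.ne, ad.ne', cb.ne, cb.ne', ab.ne, ab.ne',
        bd.ne, bd.ne'] at hva hvb hvc hvd <;> grind
  have hab := h.pattern.cyclesCompatible ab ha (by omega) hc
  have hA : (a < b → v b < v a) ∧ v d < v c ∧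
      CyclesCompatible a b (v a) (v b) c d (v c) (v d) := by
    unfold NestedValues CyclesCompatible at *
    refine ⟨?_, ?_, ?_⟩ <;> grind
  have hO : ∀ x, x ≤ y x → x ≠ a → x ≠ c →
      CyclesCompatible a b (v a) (v b) x (y x) (v x) (v (y x)) ∧
      CyclesCompatible c d (v c) (v d) x (y x) (v x) (v (y x)) := by
    intro x hx n1 n2
    obtain ⟨⟨n3, n4⟩, n5, n6, n7, n8⟩ := h.cycle_of_ne hx n1 n2
    rw [hvo x n1 n3 n2 n4, hvo (y x) n5 n6 n7 n8]
    exact hN.cyclesCompatible (wi := w i) ca bd w1 (fun h => by rw [h]) (fun h => by rw [h])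
      n1 n2 n5 n6 n8 hx (h.pattern.le_of_le hx)
      (h.pattern.cyclesCompatible ab ha hx rfl)
      (h.pattern.cyclesCompatible (by omega) hc hx rfl) (h.cover x) (h.cover (y x))
  apply isAtomPattern_of_cyclesCompatible h.invol
  · intro x hx
    by_cases n1 : x = a
    · rw [n1, ha]; rw [n1, ha] at hx; exact hA.1 hx
    by_cases n2 : x = c
    · rw [n2, hc]; exact hA.2.1
    obtain ⟨⟨n3, n4⟩, n5, n6, n7, n8⟩ := h.cycle_of_ne hx.le n1 n2
    rw [hvo x n1 n3 n2 n4, hvo (y x) n5 n6 n7 n8]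
    exact h.pattern.swap x hx
  · intro x z hx hz
    by_cases n1 : x = a
    · by_cases m1 : z = a
      · rw [n1, m1]; exact .refl
      by_cases m2 : z = c
      · rw [n1, m2, ha, hc]; exact hA.2.2
      rw [n1, ha]; exact (hO z hz m1 m2).1
    by_cases n2 : x = c
    · by_cases m1 : z = a
      · rw [n2, m1, ha, hc]; exact hA.2.2.symm
      by_cases m2 : z = c
      · rw [n2, m2]; exact .refl
      rw [n2, hc]; exact (hO z hz m1 m2).2
    by_cases m1 : z = a
    · rw [m1, ha]; exact (hO x hx n1 n2).1.symm
    by_cases m2 : z = c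
    · rw [m2, hc]; exact (hO x hx n1 n2).2.symm
    obtain ⟨⟨n3, n4⟩, n5, n6, n7, n8⟩ := h.cycle_of_ne hx n1 n2
    obtain ⟨⟨m3, m4⟩, m5, m6, m7, m8⟩ := h.cycle_of_ne hz m1 m2
    rw [hvo x n1 n3 n2 n4, hvo (y x) n5 n6 n7 n8, hvo z m1 m3 m2 m4, hvo (y z) m5 m6 m7 m8]
    exact h.pattern.cyclesCompatible hx rfl hz rfl

/-- No atom of `y` arises from `w (i, d)` by a transposition `(u, r)` with `r` outside of the two
nested cycles. -/
theorem mem_cycles_of_isAtomPattern (h : NestedSwap y w a b c d i) {u r : ℤ}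
    (hu : u = i ∨ u = d ∨ u = c)
    (h' : IsAtomPattern y (fun x => w (Equiv.swap i d (Equiv.swap u r x)))) :
    r = a ∨ r = b ∨ r = c ∨ r = d := by
  obtain ⟨v, hv⟩ : ∃ v, v = fun x => w (Equiv.swap i d (Equiv.swap u r x)) := ⟨_, rfl⟩
  rw [← hv] at h'
  have hvx := fun x => congrFun hv x
  simp only [Equiv.swap_apply_def] at hvx
  have ab := h.a_le
  have ca := h.c_lt
  have bd := h.lt_d
  have ha := h.a_apply
  have hc := h.c_apply
  have cd : c ≤ d := by omega
  obtain ⟨w1, w2, w3⟩ := h.values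
  by_contra! hr
  obtain ⟨r1, r2, r3, r4⟩ := hr
  obtain ⟨p, q, hpq, hq, hq', hrpq⟩ := exists_cycle h.invol r
  have hrpq' : r = p ∨ r = q := by omega
  have pa : p ≠ a := by rintro rfl; omega
  have pc : p ≠ c := by rintro rfl; omega
  obtain ⟨⟨n3, n4⟩, n5, n6, n7, n8⟩ := h.cycle_of_ne (hpq.trans hq.ge) pa pc
  rw [hq] at n5 n6 n7 n8
  have vab := h'.swap a
  have vcd := h'.swap c
  have vpq := h'.swap p
  have wpq := h.pattern.swap p
  rw [ha] at vab
  rw [hc] at vcd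
  rw [hq] at vpq wpq
  have hm := h.mem
  clear hv
  refine not_cyclesCompatible_swap (r := r) (wi := w i) (wr := w r) (vi := v i) (vr := v r) ca bd ab hpq
    pa n3 pc n5 n6 n7 n8 ?_ ?_ ?_ h.lt w2 (fun h => by rw [h]) vab (fun h => by rw [h]) wpq
    (fun h => by rw [h]) vpq (fun h => by rw [h]) w1 (vcd (by omega))
    (h.pattern.cyclesCompatible ab ha cd hc) (h.pattern.cyclesCompatible ab ha hpq hq)
    (h.pattern.cyclesCompatible cd hc hpq hq) (h'.cyclesCompatible ab ha cd hc)
    (h'.cyclesCompatible ab ha hpq hq) (h'.cyclesCompatible cd hc hpq hq) (h.cover p) (h.cover q)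
  · have := hvx a
    have := hvx b
    rcases hm with rfl | rfl
    · exact .inl ⟨rfl, rfl, rfl, by grind⟩
    · exact .inr ⟨rfl, rfl, rfl, by grind⟩
  · have := hvx p
    have := hvx q
    rcases hrpq' with rfl | rfl
    · exact .inl ⟨rfl, rfl, rfl, by grind⟩
    · exact .inr ⟨rfl, rfl, rfl, by grind⟩
  · have k1 := hvx i
    have k2 := hvx r
    have k3 := hvx d
    have k4 := hvx c
    have : i ≠ c := by omega
    have : i ≠ d := by omega
    have : r ≠ i := by omega
    have : c ≠ d := by omega
    clear hvx h h' hq hq' hrpq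
    rcases hu with rfl | rfl | rfl
    · left; grind
    · right; left; grind
    · right; right; grind

theorem eq_of_isAtomPattern (h : NestedSwap y w a b c d i) {t : ℤ}
    (ht : (t = a ∧ w a < w d) ∨ (t = b ∧ w c < w a)) {p q : ℤ} (hpq : p ≠ q)
    (hne : (fun x => w (Equiv.swap i d (Equiv.swap p q x))) ≠ w)
    (h' : IsAtomPattern y (fun x => w (Equiv.swap i d (Equiv.swap p q x)))) :
    (p = c ∧ q = t) ∨ (p = t ∧ q = c) := by
  have ab := h.a_le
  have ca := h.c_lt
  have bd := h.lt_d
  have ha := h.a_apply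
  have hc := h.c_apply
  have hm := h.mem
  have hid := h.lt
  obtain ⟨w1, w2, w3⟩ := h.values
  have hne' : ¬ ((p = i ∧ q = d) ∨ (p = d ∧ q = i)) := by
    rintro (⟨rfl, rfl⟩ | ⟨rfl, rfl⟩)
    · exact hne (by funext x; simp)
    · exact hne (by funext x; simp [Equiv.swap_comm])
  have hq : p = i ∨ p = d ∨ p = c → q = a ∨ q = b ∨ q = c ∨ q = d := fun hu =>
    h.mem_cycles_of_isAtomPattern hu h'
  have hp : q = i ∨ q = d ∨ q = c → p = a ∨ p = b ∨ p = c ∨ p = d := fun hu =>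
    h.mem_cycles_of_isAtomPattern hu (by simpa only [Equiv.swap_comm] using h')
  obtain ⟨v, hv⟩ : ∃ v, v = fun x => w (Equiv.swap i d (Equiv.swap p q x)) := ⟨_, rfl⟩
  rw [← hv] at h'
  have hvx := fun x => congrFun hv x
  simp only [Equiv.swap_apply_def] at hvx
  have vab := h'.swap a
  have vcd := h'.swap c
  have vi := h'.inside c i
  have va := h'.inside c a
  have vb := h'.inside c b
  rw [ha] at vab
  rw [hc] at vcd vi va vb
  have ka := hvx a
  have kb := hvx b
  have kc := hvx c
  have kd := hvx d
  have ki := hvx i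
  clear hvx hv hne h' h
  by_cases hcase : (p = i ∨ p = d ∨ p = c) ∨ (q = i ∨ q = d ∨ q = c)
  · have hpA : p = a ∨ p = b ∨ p = c ∨ p = d := by grind
    have hqA : q = a ∨ q = b ∨ q = c ∨ q = d := by grind
    clear hp hq hcase
    rcases ab.eq_or_lt with rfl | ab
    · grind
    rcases hm with rfl | rfl <;> rcases ht with ⟨rfl, ht⟩ | ⟨rfl, ht⟩ <;>
    rcases hpA with rfl | rfl | rfl | rfl <;> rcases hqA with rfl | rfl | rfl | rfl <;> grind
  · exfalso
    grind

end NestedSwap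

/-! ### Computing flattenings -/

theorem sort_eq_of_pairwise {l : List ℤ} (hl : l.Pairwise (· < ·)) {E : Finset ℤ}
    (hE : l.toFinset = E) : E.sort (· ≤ ·) = l := by
  subst hE
  have hn : l.Nodup := hl.imp fun h => h.ne
  exact (List.toFinset_sort (· ≤ ·) hn).2 (hl.imp fun h => h.le)

/-- If `l` lists the elements of `E` in increasing order, and `m` lists them in increasing order
of the values of `w`, then the one-line notation of the flattening of `w` on `E` consists of the
positions in `m` of the entries of `l`. -/
theorem oneLine_flatten {w : SZ} {E : Finset ℤ} {l m : List ℤ} (hl : l.Pairwise (· < ·))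
    (hlE : l.toFinset = E) (hm : m.Pairwise (fun x z => w.1 x < w.1 z)) (hmE : m.toFinset = E) :
    oneLine (flatten w E) = l.map (fun x => m.idxOf x + 1) := by
  have h1 := sort_eq_of_pairwise hl hlE
  have h2 : (E.map w.1.toEmbedding).sort (· ≤ ·) = m.map w.1 := by
    apply sort_eq_of_pairwise (List.pairwise_map.2 hm)
    rw [← hmE]
    ext x
    obtain ⟨z, rfl⟩ := w.1.surjective x
    simp
  have hlen : l.length = E.card := by rw [← h1, Finset.length_sort]
  apply List.ext_getElem
  · simp [oneLine, hlen]
  · intro k hk hk'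
    simp only [oneLine, List.getElem_ofFn, List.getElem_map]
    congr 1
    change (((E.map w.1.toEmbedding).orderIsoOfFin (Finset.card_map _)).symm _ : ℕ) = _
    rw [Finset.orderIsoOfFin_symm_apply, h2]
    have h3 : ∀ x, (m.map w.1).idxOf (w.1 x) = m.idxOf x := by
      intro x
      clear * -
      induction m with
      | nil => simp
      | cons a m ih =>
        by_cases h : a = x
        · simp [h]
        · rw [List.map_cons, List.idxOf_cons_ne _ (fun he => h (w.1.injective he)), ih,
            List.idxOf_cons_ne _ h]
    rw [← h3]
    congr 1
    change w.1 (E.orderEmbOfFin rfl _) = _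
    rw [Finset.orderEmbOfFin_apply]
    simp only [h1]
    rfl

theorem oneLine_flatten_three {w : SZ} {a b c : ℤ} (h : a < b ∧ b < c) {m : List ℤ}
    (hm : m.Pairwise (fun x z => w.1 x < w.1 z)) (hmE : m.toFinset = {a, b, c}) :
    oneLine (flatten w {a, b, c}) = [m.idxOf a + 1, m.idxOf b + 1, m.idxOf c + 1] := by
  rw [oneLine_flatten (l := [a, b, c]) (by simp; omega) (by simp) hm hmE]
  rfl

theorem oneLine_flatten_four {w : SZ} {a b c d : ℤ} (h : a < b ∧ b < c ∧ c < d) {m : List ℤ}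
    (hm : m.Pairwise (fun x z => w.1 x < w.1 z)) (hmE : m.toFinset = {a, b, c, d}) :
    oneLine (flatten w {a, b, c, d})
      = [m.idxOf a + 1, m.idxOf b + 1, m.idxOf c + 1, m.idxOf d + 1] := by
  rw [oneLine_flatten (l := [a, b, c, d]) (by simp; omega) (by simp) hm hmE]
  rfl

theorem oneLine_flatten_321 {w : SZ} {a b c : ℤ} (h : a < b ∧ b < c)
    (hw : w.1 c < w.1 b ∧ w.1 b < w.1 a) : oneLine (flatten w {a, b, c}) = [3, 2, 1] := by
  rw [oneLine_flatten_three h (m := [c, b, a]) (by simp; omega) (by ext; simp; tauto)]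
  simp (disch := omega) [List.idxOf_cons_ne]

theorem oneLine_flatten_231 {w : SZ} {a b c : ℤ} (h : a < b ∧ b < c)
    (hw : w.1 c < w.1 a ∧ w.1 a < w.1 b) : oneLine (flatten w {a, b, c}) = [2, 3, 1] := by
  rw [oneLine_flatten_three h (m := [c, a, b]) (by simp; omega) (by ext; simp; tauto)]
  simp (disch := omega) [List.idxOf_cons_ne]

theorem oneLine_flatten_312 {w : SZ} {a b c : ℤ} (h : a < b ∧ b < c)
    (hw : w.1 b < w.1 c ∧ w.1 c < w.1 a) : oneLine (flatten w {a, b, c}) = [3, 1, 2] := by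
  rw [oneLine_flatten_three h (m := [b, c, a]) (by simp; omega) (by ext; simp; tauto)]
  simp (disch := omega) [List.idxOf_cons_ne]

theorem oneLine_flatten_4321 {w : SZ} {a b c d : ℤ} (h : a < b ∧ b < c ∧ c < d)
    (hw : w.1 d < w.1 c ∧ w.1 c < w.1 b ∧ w.1 b < w.1 a) :
    oneLine (flatten w {a, b, c, d}) = [4, 3, 2, 1] := by
  rw [oneLine_flatten_four h (m := [d, c, b, a]) (by simp; omega) (by ext; simp; tauto)]
  simp (disch := omega) [List.idxOf_cons_ne]

theorem oneLine_flatten_2431 {w : SZ} {a b c d : ℤ} (h : a < b ∧ b < c ∧ c < d)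
    (hw : w.1 d < w.1 a ∧ w.1 a < w.1 c ∧ w.1 c < w.1 b) :
    oneLine (flatten w {a, b, c, d}) = [2, 4, 3, 1] := by
  rw [oneLine_flatten_four h (m := [d, a, c, b]) (by simp; omega) (by ext; simp; tauto)]
  simp (disch := omega) [List.idxOf_cons_ne]

theorem oneLine_flatten_3412 {w : SZ} {a b c d : ℤ} (h : a < b ∧ b < c ∧ c < d)
    (hw : w.1 c < w.1 d ∧ w.1 d < w.1 a ∧ w.1 a < w.1 b) :
    oneLine (flatten w {a, b, c, d}) = [3, 4, 1, 2] := by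
  rw [oneLine_flatten_four h (m := [c, d, a, b]) (by simp; omega) (by ext; simp; tauto)]
  simp (disch := omega) [List.idxOf_cons_ne]

theorem oneLine_flatten_4213 {w : SZ} {a b c d : ℤ} (h : a < b ∧ b < c ∧ c < d)
    (hw : w.1 c < w.1 b ∧ w.1 b < w.1 d ∧ w.1 d < w.1 a) :
    oneLine (flatten w {a, b, c, d}) = [4, 2, 1, 3] := by
  rw [oneLine_flatten_four h (m := [c, b, d, a]) (by simp; omega) (by ext; simp; tauto)]
  simp (disch := omega) [List.idxOf_cons_ne]

section

variable {y w : ℤ → ℤ} {a b c d i j : ℤ}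

theorem neg_swap_neg (p q x : ℤ) :
    -Equiv.swap (-p) (-q) (-x) = Equiv.swap p q x := by
  simp only [Equiv.swap_apply_def, neg_inj]
  split_ifs <;> simp

/-- A cycle `(a, b)` nested in a cycle `(c, d)` of `y`, and a covering transposition `(c, j)` of
an atom `w` of `y` with `j` in the inner cycle. -/
structure NestedSwapLeft (y w : ℤ → ℤ) (a b c d j : ℤ) : Prop where
  pattern : IsAtomPattern y w
  invol : ∀ x, y (y x) = x
  a_le : a ≤ b
  c_lt : c < a
  lt_d : b < d
  a_apply : y a = b
  c_apply : y c = d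
  mem : j = a ∨ j = b
  lt : w c < w j
  cover : ∀ e, c < e → e < j → w e < w c ∨ w j < w e

namespace NestedSwapLeft

theorem reflect (h : NestedSwapLeft y w a b c d j) :
    NestedSwap (fun x => -y (-x)) (fun x => -w (-x)) (-b) (-a) (-d) (-c) (-j) where
  pattern := h.pattern.neg h.invol
  invol x := by simp [h.invol]
  a_le := by have := h.a_le; omega
  c_lt := by have := h.lt_d; omega
  lt_d := by have := h.c_lt; omega
  a_apply := by rw [← h.a_apply, neg_neg, h.invol]
  c_apply := by rw [← h.c_apply, neg_neg, h.invol]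
  mem := by have := h.mem; omega
  lt := by have := h.lt; simp only [neg_neg]; omega
  cover e h1 h2 := by
    have := h.cover (-e) (by omega) (by omega)
    simp only [neg_neg]
    omega

theorem values (h : NestedSwapLeft y w a b c d j) :
    w d < w c ∧ (a < b → w b < w a) ∧ (w c < w b ∨ w b < w d) := by
  have := h.reflect.values
  simp only [neg_neg] at this
  omega

theorem isAtomPattern (h : NestedSwapLeft y w a b c d j) {t : ℤ}
    (ht : (t = b ∧ w c < w b) ∨ (t = a ∧ w b < w d)) :
    IsAtomPattern y (fun x => w (Equiv.swap c j (Equiv.swap t d x))) := by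
  have h1 := (h.reflect.isAtomPattern (t := -t) (by simp only [neg_neg]; omega)).neg
    h.reflect.invol
  simp only [neg_neg] at h1
  convert h1 using 3 with x
  rw [← neg_swap_neg c j, ← neg_swap_neg t d, neg_neg, Equiv.swap_comm (-c),
    Equiv.swap_comm (-t)]

theorem eq_of_isAtomPattern (h : NestedSwapLeft y w a b c d j) {t : ℤ}
    (ht : (t = b ∧ w c < w b) ∨ (t = a ∧ w b < w d)) {p q : ℤ} (hpq : p ≠ q)
    (hne : (fun x => w (Equiv.swap c j (Equiv.swap p q x))) ≠ w)
    (h' : IsAtomPattern y (fun x => w (Equiv.swap c j (Equiv.swap p q x)))) :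
    (p = t ∧ q = d) ∨ (p = d ∧ q = t) := by
  have he : (fun x => -w (-Equiv.swap (-j) (-c) (Equiv.swap (-p) (-q) x)))
      = fun x => -w (Equiv.swap c j (Equiv.swap p q (-x))) := by
    funext x
    rw [← neg_swap_neg c j, ← neg_swap_neg p q, neg_neg, neg_neg, Equiv.swap_comm (-c)]
  have h1 := h.reflect.eq_of_isAtomPattern (t := -t) (p := -p) (q := -q)
    (by simp only [neg_neg]; omega) (by omega) (by
      rw [he]
      intro h2
      apply hne
      funext x
      have := congrFun h2 (-x)
      simpa using this) (by
      rw [he]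
      exact h'.neg h.invol)
  omega

end NestedSwapLeft

end

/-! ### The table -/

/-- The conclusions about the transposition `(p, q)` from its uniqueness and its table row. -/
theorem exists_unique_and_matches {y w : SZ} (hy : IsInvolution y) {i j p q : ℤ} (hpq : p < q)
    (hat : IsAtomPattern y.1 (w * tr i j * tr p q).1)
    (hne : w ≠ w * tr i j * tr p q)
    (huniq : ∀ p' q' : ℤ, p' < q' → w ≠ w * tr i j * tr p' q' →
      IsAtomPattern y.1 (w * tr i j * tr p' q').1 → p' = p ∧ q' = q)
    (hmatch : MatchesTable y w i j p q) :
    (∃! p : ℤ × ℤ, p.1 < p.2 ∧ w ≠ w * tr i j * tr p.1 p.2 ∧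
      w * tr i j * tr p.1 p.2 ∈ atoms y) ∧
    oneLine (flatten w (orbitSet y i j)) ∈
      ({[2, 3, 1], [3, 1, 2], [2, 4, 3, 1], [3, 4, 1, 2], [4, 2, 1, 3]} : Set (List ℕ)) ∧
    (∀ i' j' : ℤ, i' < j' → w ≠ w * tr i j * tr i' j' → w * tr i j * tr i' j' ∈ atoms y →
      MatchesTable y w i j i' j' ∧ (i' = j ∨ i' = y.1 j) ∧ (j' = i ∨ j' = y.1 i)) := by
  refine ⟨⟨(p, q), ⟨hpq, hne, (mem_atoms_iff hy).2 hat⟩, ?_⟩, ?_, ?_⟩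
  · rintro ⟨p', q'⟩ ⟨h1, h2, h3⟩
    obtain ⟨rfl, rfl⟩ := huniq p' q' h1 h2 ((mem_atoms_iff hy).1 h3)
    rfl
  · simp only [Set.mem_insert_iff, Set.mem_singleton_iff]
    rcases hmatch with ⟨a, b, c, -, -, -, -, h⟩ | ⟨a, b, c, d, -, -, -, -, -, h⟩
    · rcases h with h | h <;> simp [h.1]
    · rcases h with h | h | h | h | h | h <;> simp [h.1]
  · intro i' j' h1 h2 h3
    obtain ⟨rfl, rfl⟩ := huniq i' j' h1 h2 ((mem_atoms_iff hy).1 h3)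
    refine ⟨hmatch, ?_⟩
    rcases hmatch with ⟨a, b, c, -, -, -, -, h⟩ | ⟨a, b, c, d, -, -, -, -, -, h⟩
    · rcases h with ⟨-, -, -, h⟩ | ⟨-, -, -, h⟩ <;> simp [h.1, h.2]
    · rcases h with ⟨-, -, -, h⟩ | ⟨-, -, -, h⟩ | ⟨-, -, -, h⟩ | ⟨-, -, -, h⟩ | ⟨-, -, -, h⟩ |
        ⟨-, -, -, h⟩ <;> simp [h.1, h.2]

theorem NestedSwap.matchesTable {y w : SZ} {a b c d i t : ℤ}
    (h : NestedSwap y.1 w.1 a b c d i)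
    (ht : (t = a ∧ w.1 a < w.1 d) ∨ (t = b ∧ w.1 c < w.1 a)) : MatchesTable y w i d c t := by
  have ab := h.a_le
  have ca := h.c_lt
  have bd := h.lt_d
  have ha := h.a_apply
  have hc := h.c_apply
  have hb : y.1 b = a := by rw [← ha, h.invol]
  have hd : y.1 d = c := by rw [← hc, h.invol]
  have hm := h.mem
  have hlt := h.lt
  obtain ⟨w1, w2, w3⟩ := h.values
  rcases ab.eq_or_lt with rfl | ab
  · obtain rfl : i = a := by omega
    obtain rfl : t = i := by omega
    have hE : orbitSet y t d = {c, t, d} := by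
      ext x; simp [orbitSet, ha, hd]; tauto
    refine .inl ⟨c, t, d, ca, bd, hE, ?_, .inr ⟨?_, rfl, rfl, hd.symm, rfl⟩⟩
    · rw [hE]; exact oneLine_flatten_321 (by omega) (by omega)
    · rw [hE]; exact oneLine_flatten_312 (by omega) (by omega)
  · have hE : orbitSet y i d = {c, a, b, d} := by
      rcases hm with rfl | rfl
      · ext x; simp [orbitSet, ha, hd]; tauto
      · ext x; simp [orbitSet, hb, hd]; tauto
    refine .inr ⟨c, a, b, d, ca, ab, bd, hE, ?_, ?_⟩
    · rw [hE]; exact oneLine_flatten_4321 (by omega) (by omega)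
    · rcases ht with ⟨rfl, ht⟩ | ⟨rfl, ht⟩
      · have hw : oneLine (flatten w (orbitSet y i d)) = [4, 2, 1, 3] := by
          rw [hE]; exact oneLine_flatten_4213 (by omega) (by omega)
        rcases hm with rfl | rfl
        · exact .inr (.inr (.inr (.inr (.inl ⟨hw, rfl, rfl, hd.symm, rfl⟩))))
        · exact .inr (.inr (.inr (.inr (.inr ⟨hw, rfl, rfl, hd.symm, hb.symm⟩))))
      · obtain rfl : i = t := by
          rcases hm with rfl | rfl
          · omega
          · rfl
        have hw : oneLine (flatten w (orbitSet y i d)) = [3, 4, 1, 2] := by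
          rw [hE]; exact oneLine_flatten_3412 (by omega) (by omega)
        exact .inr (.inr (.inr (.inl ⟨hw, rfl, rfl, hd.symm, rfl⟩)))

theorem NestedSwapLeft.matchesTable {y w : SZ} {a b c d j t : ℤ}
    (h : NestedSwapLeft y.1 w.1 a b c d j)
    (ht : (t = b ∧ w.1 c < w.1 b) ∨ (t = a ∧ w.1 b < w.1 d)) : MatchesTable y w c j t d := by
  have ab := h.a_le
  have ca := h.c_lt
  have bd := h.lt_d
  have ha := h.a_apply
  have hc := h.c_apply
  have hb : y.1 b = a := by rw [← ha, h.invol]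
  have hd : y.1 d = c := by rw [← hc, h.invol]
  have hm := h.mem
  have hlt := h.lt
  obtain ⟨w1, w2, w3⟩ := h.values
  rcases ab.eq_or_lt with rfl | ab
  · obtain rfl : j = a := by omega
    obtain rfl : t = j := by omega
    have hE : orbitSet y c t = {c, t, d} := by
      ext x; simp [orbitSet, ha, hc]; tauto
    refine .inl ⟨c, t, d, ca, bd, hE, ?_, .inl ⟨?_, rfl, rfl, rfl, hc.symm⟩⟩
    · rw [hE]; exact oneLine_flatten_321 (by omega) (by omega)
    · rw [hE]; exact oneLine_flatten_231 (by omega) (by omega)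
  · have hE : orbitSet y c j = {c, a, b, d} := by
      rcases hm with rfl | rfl
      · ext x; simp [orbitSet, ha, hc]; tauto
      · ext x; simp [orbitSet, hb, hc]; tauto
    refine .inr ⟨c, a, b, d, ca, ab, bd, hE, ?_, ?_⟩
    · rw [hE]; exact oneLine_flatten_4321 (by omega) (by omega)
    · rcases ht with ⟨rfl, ht⟩ | ⟨rfl, ht⟩
      · have hw : oneLine (flatten w (orbitSet y c j)) = [2, 4, 3, 1] := by
          rw [hE]; exact oneLine_flatten_2431 (by omega) (by omega)
        rcases hm with rfl | rfl
        · exact .inl ⟨hw, rfl, rfl, ha.symm, hc.symm⟩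
        · exact .inr (.inl ⟨hw, rfl, rfl, rfl, hc.symm⟩)
      · obtain rfl : j = t := by
          rcases hm with rfl | rfl
          · rfl
          · omega
        have hw : oneLine (flatten w (orbitSet y c j)) = [3, 4, 1, 2] := by
          rw [hE]; exact oneLine_flatten_3412 (by omega) (by omega)
        exact .inr (.inr (.inl ⟨hw, rfl, rfl, rfl, hc.symm⟩))

end InvAtoms

open InvAtoms
theorem theorem3 (y : SZ) (hy : IsInvolution y) (w : SZ) (hw : w ∈ atoms y)
    (i j : ℤ) (hij : i < j) (hcov : bruhatCovers w (w * tr i j))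
    (hno : ∀ z : SZ, IsInvolution z → w * tr i j ∉ atoms z) :
    (∃! p : ℤ × ℤ, p.1 < p.2 ∧ w ≠ w * tr i j * tr p.1 p.2 ∧
      w * tr i j * tr p.1 p.2 ∈ atoms y) ∧
    oneLine (flatten w (orbitSet y i j)) ∈
      ({[2, 3, 1], [3, 1, 2], [2, 4, 3, 1], [3, 4, 1, 2], [4, 2, 1, 3]} : Set (List ℕ)) ∧
    (∀ i' j' : ℤ, i' < j' → w ≠ w * tr i j * tr i' j' → w * tr i j * tr i' j' ∈ atoms y →
      MatchesTable y w i j i' j' ∧ (i' = j ∨ i' = y.1 j) ∧ (j' = i ∨ j' = y.1 i)) := by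
  have hp := (mem_atoms_iff hy).1 hw
  have hyy := hy.apply_apply
  have hlt := hcov.apply_lt hij
  have hbt : ∀ e, i < e → e < j → w.1 e < w.1 i ∨ w.1 j < w.1 e := fun e => hcov.not_between
  obtain ⟨a, b, ab, ha, hb, hi⟩ := exists_cycle hyy i
  obtain ⟨c, d, cd, hc, hd, hj⟩ := exists_cycle hyy j
  have hac : a ≠ c := by
    rintro rfl
    have := hp.swap a
    rw [ha] at this hc
    subst hc
    have : i = a := by omega
    have : j = b := by omega
    subst_vars
    omega
  have hbd : b ≠ d := by
    rintro rfl
    exact hac (hb.symm.trans hd)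
  have hne : ∀ p q, IsAtomPattern y.1 (w * tr i j * tr p q).1 → w ≠ w * tr i j * tr p q →
      (fun x => w.1 (Equiv.swap i j (Equiv.swap p q x))) ≠ w.1 := by
    intro p q _ h1 h2
    exact h1 (Subtype.ext (DFunLike.coe_injective h2.symm))
  have hne' : ∀ p q, p < q → ¬ (p = i ∧ q = j) → w ≠ w * tr i j * tr p q := by
    intro p q h1 h2 h3
    rw [mul_assoc, left_eq_mul, mul_eq_one_iff_eq_inv, inv_eq_of_mul_eq_one_left (tr_mul_tr p q)]
      at h3
    have e1 := congrArg (fun u : SZ => u.1 i) h3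
    have e2 := congrArg (fun u : SZ => u.1 p) h3
    simp only [tr_apply] at e1 e2
    split_ifs at e1 e2 <;> omega
  rcases lt_or_gt_of_ne hac with hac | hac <;> rcases lt_or_gt_of_ne hbd with hbd | hbd
  · have hU : UnnestedSwap y.1 w.1 (w * tr i j).1 a b c d i j := by
      refine ⟨hp, hyy, ab, cd, ha, hc, hac, hbd, hij, hbt, fun x => ?_, by omega, by omega⟩
      rw [mul_apply, tr_apply]
      split_ifs <;> simp_all
    obtain ⟨z, hz, hz'⟩ := hU.exists_mem_atoms
    exact absurd hz' (hno z hz)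
  · obtain rfl : i = a := by omega
    have hN : NestedSwapLeft y.1 w.1 c d i b j :=
      ⟨hp, hyy, cd, hac, hbd, hc, ha, by omega, hlt, hbt⟩
    obtain ⟨t, ht⟩ : ∃ t, (t = d ∧ w.1 i < w.1 d) ∨ (t = c ∧ w.1 d < w.1 b) := by
      rcases hN.values.2.2 with h | h
      · exact ⟨d, .inl ⟨rfl, h⟩⟩
      · exact ⟨c, .inr ⟨rfl, h⟩⟩
    have htb : t < b := by omega
    refine exists_unique_and_matches hy htb (hN.isAtomPattern ht) (hne' _ _ htb (by omega)) ?_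
      (hN.matchesTable ht)
    intro p q h1 h2 h3
    have := hN.eq_of_isAtomPattern ht h1.ne (hne p q h3 h2) h3
    omega
  · obtain rfl : j = d := by omega
    have hN : NestedSwap y.1 w.1 a b c j i :=
      ⟨hp, hyy, ab, hac, hbd, ha, hc, by omega, hlt, hbt⟩
    obtain ⟨t, ht⟩ : ∃ t, (t = a ∧ w.1 a < w.1 j) ∨ (t = b ∧ w.1 c < w.1 a) := by
      rcases hN.values.2.2 with h | h
      · exact ⟨a, .inl ⟨rfl, h⟩⟩
      · exact ⟨b, .inr ⟨rfl, h⟩⟩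
    have htb : c < t := by omega
    refine exists_unique_and_matches hy htb (hN.isAtomPattern ht) (hne' _ _ htb (by omega)) ?_
      (hN.matchesTable ht)
    intro p q h1 h2 h3
    have := hN.eq_of_isAtomPattern ht h1.ne (hne p q h3 h2) h3
    omega
  · have := hp.lt_of_unnested hyy (p := j) (q := i) (by omega) (by omega)
    omega
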